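/- Let $a,c\in\mathbb R$ with $a+c>0$ and let $\sigma>0$. For $L\ge 1$ let $\mathcal M^{(L)}$ be the set of Motzkin paths of length $L$, i.e. sequences $\gamma=(\gamma_0,\dots,\gamma_L)$ of non-negative integers with $|\gamma_k-\gamma_{k-1}|\le 1$ for $k=1,\dots,L$. Put $\rho_{L,0}=1-\frac{c}{\sqrt L}$, $\rho_{L,1}=1-\frac{a}{\sqrt L}$, and for $L$ so large that $\rho_{L,0},\rho_{L,1}>0$ and $\rho_{L,0}\rho_{L,1}<1$ let $\mathbb P_L$ (with expectation $\mathbb E_L$) be the probability measure on $\mathcal M^{(L)}$ given by $$\mathbb P_L(\gamma)=\frac1{\mathfrak C_L}\,\rho_{L,0}^{\gamma_0}\,\rho_{L,1}^{\gamma_L}\,\sigma^{\#\{1\le k\le L:\ \gamma_k=\gamma_{k-1}\}},$$ where $\mathfrak C_L<\infty$ is the normalizing constant. Let $d\ge 1$ and $0=x_0<x_1<\dots<x_d=1$, and set, for $k=1,\dots,d$, $$h_k=\#\{1\le j\le \lfloor Lx_k\rfloor:\ \gamma_j=\gamma_{j-1}\}-\frac{\sigma}{2+\sigma}\lfloor Lx_k\rfloor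 .$$ For $\mathbf c=(c_0,\dots,c_d)$ and $\boldsymbol\theta=(\theta_1,\dots,\theta_d)$ define $$\Phi_L(\mathbf c,\boldsymbol\theta)=\mathbb E_L\Big[\exp\Big(-\sum_{k=0}^d c_k\gamma_{\lfloor Lx_k\rfloor}+\sum_{k=1}^d\theta_k h_k\Big)\Big].$$ **Proposition 3.1.** Let $\theta_1,\dots,\theta_d\in\mathbb R$ and $c_0,\dots,c_d>0$ be such that $c+c_0>0$ and $a+c_d>0$. Then $\Phi_L(\mathbf c/\sqrt L,\boldsymbol\theta/\sqrt L)$ is finite for all large $L$, and $$\lim_{L\to\infty}\Phi_L\Big(\frac{\mathbf c}{\sqrt L},\frac{\boldsymbol\theta}{\sqrt L}\Big)=\Psi(\mathbf c)\,\exp\Big(\frac{\sigma}{(2+\sigma)^2}\sum_{k=1}^d(x_k-x_{k-1})\tilde s_k^{\,2}\Big),\qquad \tilde s_k=\sum_{j=k}^d\theta_j,$$ where $$\Psi(\mathbf c)=\frac{\sqrt{2+\sigma}}{\sqrt2\,\pi\,\mathfrak K}\int_{(0,\infty)^d}e^{-\frac1{2+\sigma}\sum_{k=1}^d(x_k-x_{k-1})u_k}\,\frac{\sqrt{u_1}}{(c+c_0)^2+u_1}\cdot\frac1{(a+c_d)^2+u_d}\,\prod_{k=1}^{d-1}p_{c_k}(u_k,u_{k+1})\,du_1\cdots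 du_d ,$$ the integral being absolutely convergent, with $$p_t(x,y)=\frac2\pi\cdot\frac{t\sqrt y}{t^4+(y-x)^2+2(y+x)t^2},$$ and, with $a'=\frac{2a}{\sqrt{2+\sigma}}$ and $c'=\frac{2c}{\sqrt{2+\sigma}}$, $$\mathfrak K=\mathfrak C_{a',c'}=\int_0^\infty\!\!\int_0^\infty e^{-(c'x+a'y)/\sqrt2}\,\frac1{\sqrt{2\pi}}\Big(e^{-(x-y)^2/2}-e^{-(x+y)^2/2}\Big)dx\,dy\in(0,\infty).$$ -/

import Mathlib

open Real Set Filter Topology MeasureTheory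

noncomputable section

/-- Motzkin paths of length `L` with arbitrary end-points: `(γ_0, …, γ_L)` of natural numbers
(so the path never falls below the horizontal axis) with `|γ_k - γ_{k-1}| ≤ 1`.
As a countable subtype of `Fin (L + 1) → ℕ` it carries the discrete σ-algebra. -/
abbrev MotzkinPath (L : ℕ) : Type :=
  {γ : Fin (L + 1) → ℕ // ∀ k : Fin L, |(γ k.succ : ℤ) - (γ k.castSucc : ℤ)| ≤ 1}

/-- The altitude `γ_t` (only times `t ≤ L` matter; later times are truncated to `L`). -/
def MotzkinPath.height {L : ℕ} (γ : MotzkinPath L) (t : ℕ) : ℕ :=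
  γ.1 ⟨min t L, Nat.lt_succ_of_le (min_le_right t L)⟩

/-- The indicator that the step from time `k` to time `k + 1` is horizontal. -/
def MotzkinPath.epsZero {L : ℕ} (γ : MotzkinPath L) (k : Fin L) : ℕ :=
  if γ.1 k.succ = γ.1 k.castSucc then 1 else 0

/-- `H_L(x)`: the number of horizontal steps among the first `⌊L x⌋` steps. -/
def MotzkinPath.horizontal {L : ℕ} (γ : MotzkinPath L) (x : ℝ) : ℕ :=
  ∑ k ∈ Finset.univ.filter (fun k : Fin L => k.1 + 1 ≤ ⌊(L : ℝ) * x⌋₊), γ.epsZero k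

/-- The edge weight `σ ^ (number of horizontal steps)`. -/
def MotzkinPath.edgeWeight {L : ℕ} (σ : ℝ) (γ : MotzkinPath L) : ℝ :=
  σ ^ ∑ k : Fin L, γ.epsZero k

/-- The weight of a path: edge weight times the geometric weights `ρ_0 ^ γ_0` and `ρ_1 ^ γ_L`
of the end-points, with `ρ_0 = 1 - c / √L` and `ρ_1 = 1 - a / √L`. -/
def MotzkinPath.weight {L : ℕ} (a c σ : ℝ) (γ : MotzkinPath L) : ℝ :=
  (1 - c / √(L : ℝ)) ^ γ.height 0 * γ.edgeWeight σ * (1 - a / √(L : ℝ)) ^ γ.height L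

/-- The normalizing constant: the total weight of all paths of length `L`. -/
def motzkinNormConst (a c σ : ℝ) (L : ℕ) : ℝ :=
  ∑' γ : MotzkinPath L, γ.weight a c σ

/-- The law of the random Motzkin path of length `L`: the discrete measure giving mass
`weight γ / (total weight)` to `γ`. (It is a probability measure for all large `L`.) -/
def motzkinLaw (a c σ : ℝ) (L : ℕ) : Measure (MotzkinPath L) :=
  Measure.sum fun γ : MotzkinPath L =>
    ENNReal.ofReal (γ.weight a c σ / motzkinNormConst a c σ L) • Measure.dirac γ

/-- The centred horizontal count `H_L(x) - σ / (2 + σ) * ⌊L x⌋`. -/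
def MotzkinPath.centredHorizontal {L : ℕ} (σ : ℝ) (γ : MotzkinPath L) (x : ℝ) : ℝ :=
  (γ.horizontal x : ℝ) - σ / (2 + σ) * (⌊(L : ℝ) * x⌋₊ : ℝ)

/-- The random variable `exp (-∑_{k=0}^d q_k γ_{⌊L x_k⌋} + ∑_{k=1}^d θ_k h_k)`, where `h_k` is
the centred horizontal count at `x_k`; the entry `k : Fin d` of `θ` is `θ_{k+1}`. -/
def motzkinExp {d : ℕ} (σ : ℝ) (x : Fin (d + 1) → ℝ) (L : ℕ)
    (q : Fin (d + 1) → ℝ) (θ : Fin d → ℝ) (γ : MotzkinPath L) : ℝ :=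
  Real.exp (-(∑ k : Fin (d + 1), q k * (γ.height ⌊(L : ℝ) * x k⌋₊ : ℝ))
    + ∑ k : Fin d, θ k * γ.centredHorizontal σ (x k.succ))

/-- The joint Laplace transform `Φ_L(q, θ)`. -/
def motzkinLaplace {d : ℕ} (a c σ : ℝ) (x : Fin (d + 1) → ℝ) (L : ℕ)
    (q : Fin (d + 1) → ℝ) (θ : Fin d → ℝ) : ℝ :=
  ∫ γ, motzkinExp σ x L q θ γ ∂(motzkinLaw a c σ L)

/-- Transition kernel of Brownian motion killed at hitting zero. -/
def killedKernel (t x y : ℝ) : ℝ :=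
  if 0 < x ∧ 0 < y then
    1 / √(2 * π * t) * (Real.exp (-(x - y) ^ 2 / (2 * t)) - Real.exp (-(x + y) ^ 2 / (2 * t)))
  else 0

/-- The constant `𝔠_{a,c} = ∫_{ℝ_+²} exp (-(c x + a y) / √2) g_1(x, y) dx dy`. -/
def boundaryConst (a c : ℝ) : ℝ :=
  ∫ p in Ioi (0 : ℝ) ×ˢ Ioi (0 : ℝ),
    Real.exp (-(c * p.1 + a * p.2) / √2) * killedKernel 1 p.1 p.2

/-- The kernel `p_t(x, y) = (2/π) t √y / (t⁴ + (y - x)² + 2 (y + x) t²)`. -/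
def bianeKernel (t x y : ℝ) : ℝ :=
  2 / π * (t * √y / (t ^ 4 + (y - x) ^ 2 + 2 * (y + x) * t ^ 2))

/-- The integrand of the limit functional, for `d = n + 1` points. Here `u k` is `u_{k+1}`, so
`u 0` is `u_1`, `u (Fin.last n)` is `u_d`, and the product runs over the `n = d - 1` pairs
`(u_k, u_{k+1})`, with parameter `q_k`, `1 ≤ k ≤ d - 1`. -/
def limitIntegrand {n : ℕ} (a c σ : ℝ) (x q : Fin (n + 2) → ℝ) (u : Fin (n + 1) → ℝ) : ℝ :=
  Real.exp (-(1 / (2 + σ)) * ∑ k : Fin (n + 1), (x k.succ - x k.castSucc) * u k)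
    * (√(u 0) / ((c + q 0) ^ 2 + u 0))
    * (1 / ((a + q (Fin.last (n + 1))) ^ 2 + u (Fin.last n)))
    * ∏ k : Fin n, bianeKernel (q k.succ.castSucc) (u k.castSucc) (u k.succ)

/-- The limit functional `Ψ`, with `a' = 2a / √(2 + σ)` and `c' = 2c / √(2 + σ)`. -/
def limitPsi {n : ℕ} (a c σ : ℝ) (x q : Fin (n + 2) → ℝ) : ℝ :=
  √(2 + σ) / (√2 * π * boundaryConst (2 * a / √(2 + σ)) (2 * c / √(2 + σ)))
    * ∫ u in {u : Fin (n + 1) → ℝ | ∀ k, 0 < u k}, limitIntegrand a c σ x q u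

end

/-! The Laplace transform is a quotient of two weighted path sums, which are treated by different
means.

Numerator. The heights enter only through the vertex weights at the times ⌊L x_k⌋, and a horizontal
step in the k-th block is counted by h_k, …, h_d, so its weight becomes σ exp(s̃_k / √L). Inside a
block the paths are governed by powers of one transfer operator, for which m ↦ sin((m + 1)φ) is an
eigenfunction with eigenvalue s + 2 cos φ; the Dirichlet condition at altitude -1 is built in.
Expanding in these functions block by block (`blockFun_succ_eq_integral`, `hasSum_blockFun`) gives a
d-fold integral involving ∑ r^l sin((l+1)α) at the two ends and ∑ r^l sin((l+1)α) sin((l+1)β) at the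
interior marks. Positivity of c + c_0, a + c_d and the c_k makes every ratio r smaller than 1 for
large L. With φ = √(u/L), the generating functions divided by √L tend to √u/(t² + u) and π√u p_t(u,
v), the normalized powers of the eigenvalues tend to exponentials, and dominated convergence applies
(`tendsto_integral_chainDensity`). The remaining factors (2 + s)^N / (2 + σ)^N, together with the
centring of the counts, are powers of the Laplace transform of a centred Bernoulli variable with p =
σ/(2 + σ); they produce the Gaussian factor (`tendsto_tilt_pow`).

Denominator. Only a + c > 0 is known, so one of the end ratios may be at least 1 and the spectral
expansion is not available. Instead the reflection principle (`hasSum_iterate_motzkinStep`) writes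
the weight of the paths between two altitudes as a difference of two coefficients of (X + σ +
X⁻¹)^L. A local limit theorem (`tendsto_walkCoeff`) gives the kernel of Brownian motion killed at 0.
Shifting the contour gives decay exp(-K|k|/√L) for every K (`exists_abs_walkCoeff_le`); with K = |c
- a| this ties the two ends together, so that growth at one is paid for by decay at the other.
Dominated convergence then yields 𝔎 (`boundaryConst_integrable_and_tendsto`). -/

theorem HasSum.of_eq {ι E : Type*} [AddCommMonoid E] [TopologicalSpace E] {f g : ι → E} {a b : E}
    (H : HasSum f a) (hf : ∀ i, g i = f i) (ha : b = a) : HasSum g b := by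
  rw [funext hf, ha]; exact H

/-! ### Generating functions of sines -/

/-- The generating function `∑ r ^ l sin ((l + 1) α)` in closed form. -/
noncomputable def sinGen (r α : ℝ) : ℝ := sin α / (1 - 2 * r * cos α + r ^ 2)

/-- The bilinear generating function `∑ r ^ l sin ((l + 1) α) sin ((l + 1) β)` in closed form. -/
noncomputable def sinKer (r α β : ℝ) : ℝ :=
  (1 - r ^ 2) * (sin α * sin β) /
    ((1 - 2 * r * cos (α - β) + r ^ 2) * (1 - 2 * r * cos (α + β) + r ^ 2))

/-- The quantity is |1 - r e^{iα}|². -/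
theorem poissonDenom_pos {r : ℝ} (h : |r| < 1) (α : ℝ) : 0 < 1 - 2 * r * cos α + r ^ 2 := by
  obtain ⟨h1, h2⟩ := abs_lt.1 h
  have hc := cos_le_one α
  have hc' := neg_one_le_cos α
  rcases le_total 0 r with h0 | h0
  · nlinarith [mul_nonneg h0 (sub_nonneg.2 hc), mul_pos (sub_pos.2 h2) (sub_pos.2 h2)]
  · nlinarith [mul_nonneg (neg_nonneg.2 h0) (by linarith : 0 ≤ cos α + 1),
      mul_pos (by linarith : 0 < 1 + r) (by linarith : 0 < 1 + r)]

/-- Geometric series with first term e^{iα} and ratio r e^{iα}, separated into real and imaginary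
parts so that both can be read off by projection. -/
theorem hasSum_pow_mul_cexp {r : ℝ} (h : |r| < 1) (α : ℝ) :
    HasSum (fun l : ℕ => ((r ^ l * cos ((l + 1) * α) : ℝ) : ℂ)
        + ((r ^ l * sin ((l + 1) * α) : ℝ) : ℂ) * Complex.I)
      ((((cos α - r) / (1 - 2 * r * cos α + r ^ 2) : ℝ) : ℂ)
        + ((sin α / (1 - 2 * r * cos α + r ^ 2) : ℝ) : ℂ) * Complex.I) := by
  have hn : ‖(r : ℂ) * Complex.exp (α * Complex.I)‖ < 1 := by
    rw [norm_mul, Complex.norm_exp_ofReal_mul_I, mul_one, Complex.norm_real]; exact h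
  have H := (hasSum_geometric_of_norm_lt_one hn).mul_left (Complex.exp (α * Complex.I))
  have hD := (poissonDenom_pos h α).ne'
  refine H.of_eq (fun l => ?_) ?_
  · rw [mul_pow, ← Complex.exp_nat_mul, mul_left_comm, ← Complex.exp_add]
    have : (α : ℂ) * Complex.I + l * (α * Complex.I) = (((l + 1) * α : ℝ) : ℂ) * Complex.I := by
      push_cast; ring
    rw [this, Complex.exp_mul_I, ← Complex.ofReal_cos, ← Complex.ofReal_sin]
    push_cast; ring
  · have h1 : (1 - (r : ℂ) * Complex.exp (α * Complex.I)) ≠ 0 := by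
      intro h0
      rw [sub_eq_zero] at h0
      rw [← h0] at hn; simp at hn
    have hD' : ((1 - 2 * r * cos α + r ^ 2 : ℝ) : ℂ) ≠ 0 := by exact_mod_cast hD
    rw [← div_eq_mul_inv, eq_div_iff h1, Complex.exp_mul_I, ← Complex.ofReal_cos,
      ← Complex.ofReal_sin]
    have hs := Complex.sin_sq α
    push_cast at hD' ⊢
    rw [div_mul_eq_mul_div, ← add_div, div_mul_eq_mul_div, div_eq_iff hD']
    linear_combination (r : ℂ) * hs - (r : ℂ) * Complex.sin α ^ 2 * Complex.I_sq

theorem hasSum_pow_mul_cos {r : ℝ} (h : |r| < 1) (α : ℝ) :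
    HasSum (fun l : ℕ => r ^ l * cos ((l + 1) * α))
      ((cos α - r) / (1 - 2 * r * cos α + r ^ 2)) := by
  simpa [-Complex.ofReal_mul, -Complex.ofReal_div, -Complex.ofReal_pow, -Complex.ofReal_cos,
    -Complex.ofReal_sin] using Complex.reCLM.hasSum (hasSum_pow_mul_cexp h α)

theorem hasSum_sinGen {r : ℝ} (h : |r| < 1) (α : ℝ) :
    HasSum (fun l : ℕ => r ^ l * sin ((l + 1) * α)) (sinGen r α) := by
  simpa [-Complex.ofReal_mul, -Complex.ofReal_div, -Complex.ofReal_pow, -Complex.ofReal_cos,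
    -Complex.ofReal_sin, sinGen] using Complex.imCLM.hasSum (hasSum_pow_mul_cexp h α)

theorem hasSum_sinKer {r : ℝ} (h : |r| < 1) (α β : ℝ) :
    HasSum (fun l : ℕ => r ^ l * (sin ((l + 1) * α) * sin ((l + 1) * β))) (sinKer r α β) := by
  have H := ((hasSum_pow_mul_cos h (α - β)).sub (hasSum_pow_mul_cos h (α + β))).mul_left (1 / 2)
  have h1 := (poissonDenom_pos h (α - β)).ne'
  have h2 := (poissonDenom_pos h (α + β)).ne'
  refine H.of_eq (fun l => ?_) ?_
  · rw [mul_sub (_ : ℝ) α, mul_add (_ : ℝ) α, cos_sub, cos_add]; ring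
  · rw [sinKer, div_sub_div _ _ h1 h2, mul_div_assoc', div_left_inj' (mul_ne_zero h1 h2)]
    have : sin α * sin β = (cos (α - β) - cos (α + β)) / 2 := by rw [cos_sub, cos_add]; ring
    rw [this]; ring

/-- Comparison with ∑ r^l. The resulting bounds 1/(1 - r), uniform in the angles, are of order √L
and are all that domination requires of the generating functions. -/
theorem abs_le_of_hasSum_pow {r : ℝ} (h0 : 0 ≤ r) (h : r < 1) {b : ℕ → ℝ} (hb : ∀ l, |b l| ≤ 1)
    {s : ℝ} (hs : HasSum (fun l : ℕ => r ^ l * b l) s) : |s| ≤ 1 / (1 - r) := by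
  rw [one_div]
  refine hs.norm_le_of_bounded (hasSum_geometric_of_lt_one h0 h) fun l => ?_
  rw [Real.norm_eq_abs, abs_mul, abs_of_nonneg (pow_nonneg h0 l)]
  exact mul_le_of_le_one_right (pow_nonneg h0 l) (hb l)

theorem abs_sinGen_le {r : ℝ} (h0 : 0 ≤ r) (h : r < 1) (α : ℝ) : |sinGen r α| ≤ 1 / (1 - r) :=
  abs_le_of_hasSum_pow h0 h (fun _ => abs_sin_le_one _)
    (hasSum_sinGen (by rwa [abs_of_nonneg h0]) α)

theorem abs_sinKer_le {r : ℝ} (h0 : 0 ≤ r) (h : r < 1) (α β : ℝ) :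
    |sinKer r α β| ≤ 1 / (1 - r) :=
  abs_le_of_hasSum_pow h0 h
    (fun _ => by rw [abs_mul]; exact mul_le_one₀ (abs_sin_le_one _) (abs_nonneg _) (abs_sin_le_one _))
    (hasSum_sinKer (by rwa [abs_of_nonneg h0]) α β)

@[fun_prop]
theorem Measurable.sinGen {Y : Type*} [MeasurableSpace Y] {f : Y → ℝ} (hf : Measurable f) (r : ℝ) :
    Measurable fun y => sinGen r (f y) := by
  unfold _root_.sinGen; fun_prop

@[fun_prop]
theorem Measurable.sinKer {Y : Type*} [MeasurableSpace Y] {f g : Y → ℝ} (hf : Measurable f)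
    (hg : Measurable g) (r : ℝ) : Measurable fun y => sinKer r (f y) (g y) := by
  unfold _root_.sinKer; fun_prop

/-- If `b → 1` and `N (b - 1) → ℓ` then `b ^ N → exp ℓ`. -/
theorem tendsto_pow_exp {ι : Type*} {l : Filter ι} {b : ι → ℝ} {N : ι → ℕ} {ℓ : ℝ}
    (hb : Tendsto b l (𝓝 1)) (h : Tendsto (fun i => (N i : ℝ) * (b i - 1)) l (𝓝 ℓ)) :
    Tendsto (fun i => b i ^ N i) l (𝓝 (rexp ℓ)) := by
  have hs : Tendsto (dslope Real.log 1) (𝓝 1) (𝓝 1) := by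
    have := (continuousAt_dslope_same.2 (Real.differentiableAt_log one_ne_zero)).tendsto
    simpa using this
  have h1 : Tendsto (fun i => ((N i : ℝ) * (b i - 1)) * dslope Real.log 1 (b i)) l (𝓝 ℓ) := by
    simpa using h.mul (hs.comp hb)
  refine ((Real.continuous_exp.tendsto ℓ).comp h1).congr' ?_
  filter_upwards [hb.eventually (lt_mem_nhds one_pos)] with i hi
  have : (b i - 1) * dslope Real.log 1 (b i) = Real.log (b i) := by
    simpa using sub_smul_dslope Real.log 1 (b i)
  simp only [Function.comp_apply]
  rw [mul_assoc, this, ← Real.log_pow, Real.exp_log (pow_pos hi _)]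

/-! ### Transfer operator and spectral representation -/

/-- One step of the transfer operator of Motzkin paths with weight `s` for horizontal steps. -/
noncomputable def motzkinStep (s : ℝ) (f : ℕ → ℝ) (m : ℕ) : ℝ :=
  f (m + 1) + s * f m + if m = 0 then 0 else f (m - 1)

/-- Weighted number of paths ending at a given altitude, for paths made of blocks: the `k`-th
block has `N k` steps, horizontal steps of weight `s k`, and the altitudes `m` at the ends of the
blocks have weights `r k ^ m`. -/
noncomputable def blockFun (r s : ℕ → ℝ) (N : ℕ → ℕ) : ℕ → ℕ → ℝ
  | 0 => fun m => r 0 ^ m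
  | k + 1 => fun m => r (k + 1) ^ m * ((motzkinStep (s k))^[N k] (blockFun r s N k)) m

/-- The sine functions `sin ((m + 1) φ)` are orthonormal for the density `w` with respect to
the measure `μ`. -/
structure IsSineBasis (w φ : ℝ → ℝ) (μ : Measure ℝ) : Prop where
  measurable_angle : Measurable φ
  integrable_weight : Integrable w μ
  orthonormal : ∀ m l : ℕ,
    ∫ u, w u * (sin ((m + 1) * φ u) * sin ((l + 1) * φ u)) ∂μ = if l = m then 1 else 0

/-- The density in the spectral representation of `blockFun`. -/
noncomputable def chainDensity (w φ : ℝ → ℝ) (r s : ℕ → ℝ) (N : ℕ → ℕ) (k : ℕ)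
    (u : Fin (k + 1) → ℝ) : ℝ :=
  (∏ i, w (u i) * (s i + 2 * cos (φ (u i))) ^ N i) *
    (sinGen (r 0) (φ (u 0)) *
      ∏ i : Fin k, sinKer (r (i + 1)) (φ (u i.castSucc)) (φ (u i.succ)))

theorem MeasureTheory.Integrable.mul_of_abs_le {Y : Type*} [MeasurableSpace Y] {η : Measure Y}
    {f g : Y → ℝ} {C : ℝ} (hf : Integrable f η) (hg : AEStronglyMeasurable g η)
    (h : ∀ y, |g y| ≤ C) : Integrable (fun y => f y * g y) η :=
  hf.mul_bdd hg (ae_of_all _ h)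

/-- Since sin((m+2)φ) + sin(mφ) = 2 cos φ sin((m+1)φ), each step multiplies the density by s + 2 cos
φ. The space `Y` is arbitrary because the lemma is also applied to a product space, with φ depending
on one coordinate. -/
theorem iterate_motzkinStep_integral {Y : Type*} [MeasurableSpace Y] {η : Measure Y}
    {φ : Y → ℝ} (hφ : Measurable φ) (s : ℝ) (N : ℕ) {g : Y → ℝ} (hg : Integrable g η) :
    (motzkinStep s)^[N] (fun m : ℕ => ∫ y, g y * sin ((m + 1) * φ y) ∂η) =
      fun m : ℕ => ∫ y, g y * (s + 2 * cos (φ y)) ^ N * sin ((m + 1) * φ y) ∂η := by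
  induction N generalizing g with
  | zero => simp
  | succ N ih =>
    have hsin : ∀ (g : Y → ℝ), Integrable g η → ∀ t : ℝ,
        Integrable (fun y => g y * sin (t * φ y)) η := fun g hg t =>
      hg.mul_of_abs_le (by fun_prop) (fun _ => abs_sin_le_one _)
    have hg' : Integrable (fun y => g y * (s + 2 * cos (φ y))) η := by
      refine hg.mul_of_abs_le (C := |s| + 2) (by fun_prop) fun y => ?_
      refine (abs_add_le _ _).trans ?_
      rw [abs_mul, abs_two]
      linarith [abs_cos_le_one (φ y)]
    have key : motzkinStep s (fun m : ℕ => ∫ y, g y * sin ((m + 1) * φ y) ∂η) =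
        fun m : ℕ => ∫ y, g y * (s + 2 * cos (φ y)) * sin ((m + 1) * φ y) ∂η := by
      funext m
      have e : ∀ y, g y * (s + 2 * cos (φ y)) * sin ((m + 1) * φ y) =
          g y * sin ((m + 1 + 1) * φ y) + s * (g y * sin ((m + 1) * φ y))
            + g y * sin (m * φ y) := by
        intro y
        have h1 : ((m : ℝ) + 1 + 1) * φ y = (m + 1) * φ y + φ y := by ring
        have h2 : (m : ℝ) * φ y = (m + 1) * φ y - φ y := by ring
        rw [h1, h2, sin_add, sin_sub]; ring
      simp_rw [e]
      have hadd : Integrable (fun y => g y * sin (((m : ℝ) + 1 + 1) * φ y)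
          + s * (g y * sin (((m : ℝ) + 1) * φ y))) η := (hsin g hg _).add ((hsin g hg _).const_mul s)
      rw [integral_add hadd (hsin g hg _), integral_add (hsin g hg _) ((hsin g hg _).const_mul s), integral_const_mul, motzkinStep]
      -- At m = 0 the missing downward neighbour agrees with sin(0 · φ) = 0.
      rcases m with _ | m
      · simp
      · simp
    rw [Function.iterate_succ_apply, key, ih hg']
    funext m
    congr 1; funext y; rw [pow_succ']; ring

namespace IsSineBasis

variable {w φ : ℝ → ℝ} {μ : Measure ℝ}

/-- Termwise integration against sin((m+1)φ): orthonormality keeps only l = m. Completeness is not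
needed, since `g` is given by its sine series. -/
theorem integral_expansion (H : IsSineBasis w φ μ) {f : ℕ → ℝ} (hf : Summable fun l => |f l|)
    {g : ℝ → ℝ} (hg : ∀ u, HasSum (fun l : ℕ => f l * sin ((l + 1) * φ u)) (g u)) (m : ℕ) :
    f m = ∫ u, w u * g u * sin ((m + 1) * φ u) ∂μ := by
  have hφ := H.measurable_angle
  have hw := H.integrable_weight
  have hint : ∀ l : ℕ, Integrable
      (fun u => w u * (f l * (sin ((m + 1) * φ u) * sin ((l + 1) * φ u)))) μ := fun l => by
    refine hw.mul_of_abs_le (C := |f l|) (by fun_prop) fun u => ?_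
    rw [abs_mul, abs_mul]
    exact mul_le_of_le_one_right (abs_nonneg _)
      (mul_le_one₀ (abs_sin_le_one _) (abs_nonneg _) (abs_sin_le_one _))
  have hsum : Summable fun l : ℕ =>
      ∫ u, ‖w u * (f l * (sin ((m + 1) * φ u) * sin ((l + 1) * φ u)))‖ ∂μ := by
    refine (hf.mul_right (∫ u, ‖w u‖ ∂μ)).of_nonneg_of_le
      (fun l => integral_nonneg fun _ => norm_nonneg _) fun l => ?_
    rw [← integral_const_mul]
    refine integral_mono (hint l).norm (hw.norm.const_mul _) fun u => ?_
    simp only [Real.norm_eq_abs, abs_mul]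
    have : |sin ((m + 1) * φ u)| * |sin ((l + 1) * φ u)| ≤ 1 :=
      mul_le_one₀ (abs_sin_le_one _) (abs_nonneg _) (abs_sin_le_one _)
    calc |w u| * (|f l| * (|sin ((m + 1) * φ u)| * |sin ((l + 1) * φ u)|))
        ≤ |w u| * (|f l| * 1) := by gcongr
      _ = |f l| * |w u| := by ring
  have h1 := hasSum_integral_of_summable_integral_norm hint hsum
  have h2 : ∀ l : ℕ, ∫ u, w u * (f l * (sin ((m + 1) * φ u) * sin ((l + 1) * φ u))) ∂μ =
      if l = m then f m else 0 := fun l => by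
    have : ∀ u, w u * (f l * (sin ((m + 1) * φ u) * sin ((l + 1) * φ u))) =
        f l * (w u * (sin ((m + 1) * φ u) * sin ((l + 1) * φ u))) := fun u => by ring
    simp_rw [this, integral_const_mul, H.orthonormal]
    split_ifs with h <;> simp [h]
  simp_rw [h2] at h1
  rw [(hasSum_ite_eq m (f m)).unique h1]
  congr 1; funext u
  rw [← ((hg u).mul_left (w u * sin ((m + 1) * φ u))).tsum_eq.trans (by ring :
    _ = w u * g u * sin ((m + 1) * φ u))]
  exact tsum_congr fun l => by ring

variable {r s : ℕ → ℝ} {N : ℕ → ℕ}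

theorem integrable_chainDensity [SigmaFinite μ] (H : IsSineBasis w φ μ) (h0 : ∀ k, 0 ≤ r k)
    (h1 : ∀ k, r k < 1) (k : ℕ) :
    Integrable (chainDensity w φ r s N k) (Measure.pi fun _ => μ) := by
  have hφ := H.measurable_angle
  refine Integrable.mul_of_abs_le
    (C := 1 / (1 - r 0) * ∏ i : Fin k, 1 / (1 - r (i + 1))) ?_ ?_ fun u => ?_
  · refine Integrable.fintype_prod
      (f := fun (i : Fin (k + 1)) u => w u * (s i + 2 * cos (φ u)) ^ N i) fun i => ?_
    refine H.integrable_weight.mul_of_abs_le (C := (|s i| + 2) ^ N i) (by fun_prop) fun y => ?_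
    rw [abs_pow]
    gcongr
    refine (abs_add_le _ _).trans ?_
    rw [abs_mul, abs_two]
    linarith [abs_cos_le_one (φ y)]
  · refine Measurable.aestronglyMeasurable ?_
    fun_prop
  · rw [abs_mul, Finset.abs_prod]
    have h1' : ∀ k, 0 ≤ 1 / (1 - r k) := fun k => one_div_nonneg.2 (sub_nonneg.2 (h1 k).le)
    refine mul_le_mul (abs_sinGen_le (h0 _) (h1 _) _) ?_ (by positivity) (h1' _)
    exact Finset.prod_le_prod (fun _ _ => abs_nonneg _) fun i _ => abs_sinKer_le (h0 _) (h1 _) _ _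

/-- Induction on the number of blocks. At a mark, r^m sin((m+1)α) is expanded again in the sine
basis; its sine series sums to `sinKer`, which introduces one new variable, and the next block
multiplies by a power of the eigenvalue. -/
theorem blockFun_succ_eq_integral [SigmaFinite μ] (H : IsSineBasis w φ μ) (h0 : ∀ k, 0 ≤ r k)
    (h1 : ∀ k, r k < 1) (k : ℕ) :
    blockFun r s N (k + 1) = fun m : ℕ => r (k + 1) ^ m *
      ∫ u, chainDensity w φ r s N k u * sin ((m + 1) * φ (u (Fin.last k)))
        ∂(Measure.pi fun _ => μ) := by
  have hφ := H.measurable_angle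
  have hr : ∀ k, |r k| < 1 := fun k => by rw [abs_of_nonneg (h0 k)]; exact h1 k
  have hrs : ∀ k, Summable fun l : ℕ => |r k ^ l| := fun k => by
    simp_rw [abs_pow]; exact summable_geometric_of_lt_one (abs_nonneg _) (hr k)
  induction k with
  | zero =>
    have e : blockFun r s N 0 = fun m : ℕ => ∫ u, w u * sinGen (r 0) (φ u) * sin ((m + 1) * φ u) ∂μ :=
      funext fun m => H.integral_expansion (hrs 0) (fun u => hasSum_sinGen (hr 0) (φ u)) m
    have hi : Integrable (fun u => w u * sinGen (r 0) (φ u)) μ :=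
      H.integrable_weight.mul_of_abs_le
        (hφ.sinGen _).aestronglyMeasurable
        (fun u => abs_sinGen_le (h0 0) (h1 0) _)
    rw [blockFun, e, iterate_motzkinStep_integral hφ _ _ hi]
    funext m
    refine congrArg _ ?_
    beta_reduce
    rw [← (measurePreserving_funUnique μ (Fin 1)).integral_comp']
    congr 1; funext u
    simp only [chainDensity, MeasurableEquiv.funUnique]
    simp
    left; ring
  | succ k ih =>
    set G := chainDensity w φ r s N k with hG
    have hGi : Integrable G (Measure.pi fun _ => μ) := H.integrable_chainDensity h0 h1 k
    have hm : Measurable fun p : ℝ × (Fin (k + 1) → ℝ) =>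
        sinKer (r (k + 1)) (φ (p.2 (Fin.last k))) (φ p.1) := by fun_prop
    have hwG : Integrable (fun p : ℝ × (Fin (k + 1) → ℝ) => w p.1 * G p.2)
      (μ.prod (Measure.pi fun _ => μ)) := H.integrable_weight.mul_prod hGi
    have hi : Integrable (fun p : ℝ × (Fin (k + 1) → ℝ) => w p.1 * G p.2 *
        sinKer (r (k + 1)) (φ (p.2 (Fin.last k))) (φ p.1)) (μ.prod (Measure.pi fun _ => μ)) :=
      hwG.mul_of_abs_le hm.aestronglyMeasurable
        (fun u => abs_sinKer_le (h0 _) (h1 _) _ _)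
    -- The new spectral variable is `p.1`; the old ones are kept in `p.2`.
    have e : blockFun r s N (k + 1) = fun m : ℕ => ∫ p : ℝ × (Fin (k + 1) → ℝ),
        (w p.1 * G p.2 * sinKer (r (k + 1)) (φ (p.2 (Fin.last k))) (φ p.1)) *
          sin ((m + 1) * φ p.1) ∂(μ.prod (Measure.pi fun _ => μ)) := by
      rw [ih]
      funext m
      rw [integral_prod_symm _ (hi.mul_of_abs_le (Measurable.aestronglyMeasurable (by fun_prop)) fun _ => abs_sin_le_one _),
        ← integral_const_mul]
      congr 1; funext u
      have := H.integral_expansion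
        (f := fun l => r (k + 1) ^ l * sin ((l + 1) * φ (u (Fin.last k))))
        ((hrs (k + 1)).of_nonneg_of_le (fun _ => abs_nonneg _) fun l => by
          rw [abs_mul]; exact mul_le_of_le_one_right (abs_nonneg _) (abs_sin_le_one _))
        (fun v => (hasSum_sinKer (hr (k + 1)) (φ (u (Fin.last k))) (φ v)).of_eq
          (fun l => by ring) rfl) m
      rw [mul_left_comm, this, ← integral_const_mul]
      congr 1; funext v; ring
    have hφ' : Measurable fun p : ℝ × (Fin (k + 1) → ℝ) => φ p.1 := by fun_prop
    rw [blockFun, e, iterate_motzkinStep_integral hφ' _ _ hi]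
    funext m
    refine congrArg _ ?_
    beta_reduce
    -- The new variable becomes the last coordinate of a single point of the product space.
    rw [← (measurePreserving_piFinSuccAbove (fun _ => μ) (Fin.last (k + 1))).integral_comp']
    congr 1; funext u
    simp only [MeasurableEquiv.piFinSuccAbove, MeasurableEquiv.coe_mk, Fin.insertNthEquiv,
      Equiv.coe_fn_symm_mk, hG, chainDensity, Fin.removeNth, Fin.succAbove_last]
    rw [Fin.prod_univ_castSucc (n := k + 1), 
      Fin.prod_univ_castSucc (fun i : Fin (k + 1) =>
        sinKer (r (i + 1)) (φ (u i.castSucc)) (φ (u i.succ)))]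
    simp
    left; ring

/-- Summing r^m sin((m+1)φ) over the final altitude under the integral sign gives the second
`sinGen`. -/
theorem hasSum_blockFun [SigmaFinite μ] (H : IsSineBasis w φ μ) (h0 : ∀ k, 0 ≤ r k)
    (h1 : ∀ k, r k < 1) (k : ℕ) :
    HasSum (blockFun r s N (k + 1))
      (∫ u, chainDensity w φ r s N k u * sinGen (r (k + 1)) (φ (u (Fin.last k)))
        ∂(Measure.pi fun _ => μ)) := by
  have hφ := H.measurable_angle
  have hr : |r (k + 1)| < 1 := by rw [abs_of_nonneg (h0 _)]; exact h1 _
  set G := chainDensity w φ r s N k with hG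
  have hGi : Integrable G (Measure.pi fun _ => μ) := H.integrable_chainDensity h0 h1 k
  rw [H.blockFun_succ_eq_integral h0 h1]
  have hi : ∀ m : ℕ, Integrable (fun u => G u * (r (k + 1) ^ m *
      sin ((m + 1) * φ (u (Fin.last k))))) (Measure.pi fun _ => μ) := fun m : ℕ => by
    have : Measurable fun u : Fin (k + 1) → ℝ => r (k + 1) ^ m *
      sin ((m + 1) * φ (u (Fin.last k))) := by fun_prop
    refine hGi.mul_of_abs_le (C := |r (k + 1) ^ m|) this.aestronglyMeasurable fun u => ?_
    rw [abs_mul]; exact mul_le_of_le_one_right (abs_nonneg _) (abs_sin_le_one _)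
  have hs : Summable fun m : ℕ => ∫ u, ‖G u * (r (k + 1) ^ m *
      sin ((m + 1) * φ (u (Fin.last k))))‖ ∂(Measure.pi fun _ => μ) := by
    refine ((summable_geometric_of_lt_one (abs_nonneg _) hr).mul_right
      (∫ u, ‖G u‖ ∂(Measure.pi fun _ => μ))).of_nonneg_of_le
      (fun l => integral_nonneg fun _ => norm_nonneg _) fun m => ?_
    rw [← integral_const_mul]
    refine integral_mono (hi m).norm (hGi.norm.const_mul _) fun u => ?_
    simp only [Real.norm_eq_abs, abs_mul, abs_pow]
    calc _ ≤ |G u| * (|r (k + 1)| ^ m * 1) := by gcongr; exact abs_sin_le_one _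
      _ = _ := by ring
  refine (hasSum_integral_of_summable_integral_norm hi hs).of_eq (fun m => ?_) ?_
  · rw [← integral_const_mul]
    congr 1; funext u; ring
  · congr 1; funext u
    exact ((hasSum_sinGen hr _).mul_left (G u)).tsum_eq.symm

end IsSineBasis

/-! ### Path sums as iterates of the transfer operator -/

/-- The weight of a step from altitude `m` to altitude `m'`. -/
noncomputable def stepWeight (s : ℝ) (m m' : ℕ) : ℝ :=
  if m' = m then s else if m' = m + 1 ∨ m = m' + 1 then 1 else 0

/-- Total weight of the paths of length `L` ending at a given altitude, where the altitude `m` at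
time `j` has weight `z j ^ m` and the horizontal step from `j` to `j + 1` has weight `s j`. -/
noncomputable def endFun (z s : ℕ → ℝ) : ℕ → ℕ → ℝ
  | 0 => fun m => z 0 ^ m
  | L + 1 => fun m => z (L + 1) ^ m * motzkinStep (s L) (endFun z s L) m

/-- The product of the vertex and step weights along a sequence of altitudes. -/
noncomputable def pathWeight (z s : ℕ → ℝ) (L : ℕ) (γ : Fin (L + 1) → ℕ) : ℝ :=
  (∏ j : Fin (L + 1), z j ^ γ j) * ∏ j : Fin L, stepWeight (s j) (γ j.castSucc) (γ j.succ)

theorem stepWeight_nonneg {s : ℝ} (hs : 0 ≤ s) (m m' : ℕ) : 0 ≤ stepWeight s m m' := by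
  unfold stepWeight; split_ifs <;> simp [hs]

theorem motzkinStep_nonneg {s : ℝ} (hs : 0 ≤ s) {f : ℕ → ℝ} (hf : ∀ m, 0 ≤ f m) (m : ℕ) :
    0 ≤ motzkinStep s f m := by
  have := mul_nonneg hs (hf m)
  have h1 := hf (m + 1)
  have h2 := hf (m - 1)
  unfold motzkinStep; split_ifs <;> linarith

theorem endFun_nonneg {z s : ℕ → ℝ} (hz : ∀ j, 0 ≤ z j) (hs : ∀ j, 0 ≤ s j) (L m : ℕ) :
    0 ≤ endFun z s L m := by
  induction L generalizing m with
  | zero => exact pow_nonneg (hz 0) m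
  | succ L ih => exact mul_nonneg (pow_nonneg (hz _) m) (motzkinStep_nonneg (hs L) ih m)

theorem pathWeight_nonneg {z s : ℕ → ℝ} (hz : ∀ j, 0 ≤ z j) (hs : ∀ j, 0 ≤ s j) (L : ℕ)
    (γ : Fin (L + 1) → ℕ) : 0 ≤ pathWeight z s L γ :=
  mul_nonneg (Finset.prod_nonneg fun _ _ => pow_nonneg (hz _) _)
    (Finset.prod_nonneg fun _ _ => stepWeight_nonneg (hs _) _ _)

theorem tsum_mul_stepWeight {s : ℝ} (hs : 0 ≤ s) {f : ℕ → ℝ} (hf : ∀ m, 0 ≤ f m) (m' : ℕ) :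
    ∑' m, ENNReal.ofReal (f m) * ENNReal.ofReal (stepWeight s m m') =
      ENNReal.ofReal (motzkinStep s f m') := by
  -- Only the neighbours of `m'` contribute; `m' - 1` is left out at `m' = 0`, where truncated
  -- subtraction would return 0 itself.
  rw [tsum_eq_sum (s := insert (m' + 1) (insert m' (if m' = 0 then ∅ else {m' - 1})))]
  · rw [motzkinStep]
    rcases m' with _ | k
    · simp [stepWeight]
      rw [ENNReal.ofReal_add (hf _) (mul_nonneg hs (hf _)), ENNReal.ofReal_mul hs,
        mul_comm (ENNReal.ofReal s)]
    · simp only [stepWeight, Nat.add_eq_zero_iff, one_ne_zero, and_false, if_false,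
        Nat.add_sub_cancel]
      rw [Finset.sum_insert (by simp; omega), Finset.sum_insert (by simp), Finset.sum_singleton]
      simp
      rw [← add_assoc, ENNReal.ofReal_add (add_nonneg (hf _) (mul_nonneg hs (hf _))) (hf _),
        ENNReal.ofReal_add (hf _) (mul_nonneg hs (hf _)), ENNReal.ofReal_mul hs,
        mul_comm (ENNReal.ofReal s)]
  · intro m hm
    simp only [Finset.mem_insert, not_or] at hm
    have h3 : m' = 0 ∨ m ≠ m' - 1 := by
      by_contra! h
      simp [h.1, h.2] at hm
    have : stepWeight s m m' = 0 := by
      unfold stepWeight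
      rw [if_neg (by omega), if_neg (by omega)]
    simp [this]

/-- Induction on the length, removing the last altitude. The test function `g` of the end-point is
general so that the last step and vertex weights can be absorbed into it; working in `ENNReal` makes
every exchange of sums free. -/
theorem tsum_pathWeight {z s : ℕ → ℝ} (hz : ∀ j, 0 ≤ z j) (hs : ∀ j, 0 ≤ s j) (L : ℕ)
    (g : ℕ → ENNReal) :
    ∑' γ : Fin (L + 1) → ℕ, ENNReal.ofReal (pathWeight z s L γ) * g (γ (Fin.last L)) =
      ∑' m, ENNReal.ofReal (endFun z s L m) * g m := by
  induction L generalizing g with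
  | zero =>
    rw [← (Equiv.funUnique (Fin 1) ℕ).symm.tsum_eq]
    simp [pathWeight, endFun]
  | succ L ih =>
    rw [← (Fin.snocEquiv fun _ : Fin (L + 2) => ℕ).tsum_eq, ENNReal.tsum_prod (f := fun m γ =>
        ENNReal.ofReal (pathWeight z s (L + 1) (Fin.snocEquiv (fun _ : Fin (L + 2) => ℕ) (m, γ))) *
          g (Fin.snocEquiv (fun _ : Fin (L + 2) => ℕ) (m, γ) (Fin.last (L + 1)))),
      ENNReal.tsum_comm]
    have e : ∀ (γ : Fin (L + 1) → ℕ) (m : ℕ),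
        ENNReal.ofReal (pathWeight z s (L + 1) (Fin.snocEquiv (fun _ : Fin (L + 2) => ℕ) (m, γ))) *
          g (Fin.snocEquiv (fun _ : Fin (L + 2) => ℕ) (m, γ) (Fin.last (L + 1))) =
        ENNReal.ofReal (pathWeight z s L γ) *
          (ENNReal.ofReal (stepWeight (s L) (γ (Fin.last L)) m) *
            (ENNReal.ofReal (z (L + 1) ^ m) * g m)) := by
      intro γ m
      have : pathWeight z s (L + 1) (Fin.snocEquiv (fun _ : Fin (L + 2) => ℕ) (m, γ)) =
          pathWeight z s L γ * stepWeight (s L) (γ (Fin.last L)) m * z (L + 1) ^ m := by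
        unfold pathWeight
        rw [Fin.prod_univ_castSucc, Fin.prod_univ_castSucc (fun j : Fin (L + 1) => stepWeight (s j)
          (Fin.snocEquiv (fun _ : Fin (L + 2) => ℕ) (m, γ) j.castSucc)
          (Fin.snocEquiv (fun _ : Fin (L + 2) => ℕ) (m, γ) j.succ))]
        simp only [Fin.snocEquiv_apply, Fin.snoc_castSucc, Fin.snoc_last, Fin.succ_castSucc,
          Fin.val_castSucc, Fin.val_last, Fin.succ_last]
        ring
      rw [this, ENNReal.ofReal_mul (mul_nonneg (pathWeight_nonneg hz hs _ _)
        (stepWeight_nonneg (hs _) _ _)), ENNReal.ofReal_mul (pathWeight_nonneg hz hs _ _)]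
      simp only [Fin.snocEquiv_apply, Fin.snoc_last]
      ring
    simp_rw [e, ENNReal.tsum_mul_left]
    rw [ih fun m => ∑' m', ENNReal.ofReal (stepWeight (s L) m m') *
      (ENNReal.ofReal (z (L + 1) ^ m') * g m')]
    simp_rw [← ENNReal.tsum_mul_left]
    rw [ENNReal.tsum_comm]
    refine tsum_congr fun m' => ?_
    rw [endFun, ENNReal.ofReal_mul (pow_nonneg (hz _) _),
      ← tsum_mul_stepWeight (hs L) (endFun_nonneg hz hs L), ← ENNReal.tsum_mul_left,
      ← ENNReal.tsum_mul_right]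
    refine tsum_congr fun m => by ring

/-- Between marks the vertex weights are 1, so a block is a pure power of `motzkinStep`. Its length
is written `t + 1` because the weight at its right end is applied by the last step. -/
theorem endFun_add {z s : ℕ → ℝ} {s₀ : ℝ} (a t : ℕ) (hz : ∀ j, a < j → j < a + (t + 1) → z j = 1)
    (hs : ∀ j, a ≤ j → j < a + (t + 1) → s j = s₀) :
    endFun z s (a + (t + 1)) =
      fun m => z (a + (t + 1)) ^ m * ((motzkinStep s₀)^[t + 1] (endFun z s a)) m := by
  have key : ∀ i ≤ t, endFun z s (a + i) = (motzkinStep s₀)^[i] (endFun z s a) := by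
    intro i
    induction i with
    | zero => simp
    | succ i ih =>
      intro hi
      funext m
      rw [← add_assoc, endFun, hz _ (by omega) (by omega), hs _ (by omega) (by omega),
        ih (by omega), Function.iterate_succ_apply']
      simp
  funext m
  rw [← add_assoc, endFun, hs _ (by omega) (by omega), key t le_rfl, Function.iterate_succ_apply']

theorem endFun_eq_blockFun {z s r t : ℕ → ℝ} {τ : ℕ → ℕ} {K : ℕ} (hτ0 : τ 0 = 0)
    (hτ : ∀ k < K, τ k < τ (k + 1)) (hzr : ∀ k ≤ K, z (τ k) = r k)
    (hz : ∀ k < K, ∀ j, τ k < j → j < τ (k + 1) → z j = 1)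
    (hs : ∀ k < K, ∀ j, τ k ≤ j → j < τ (k + 1) → s j = t k) :
    endFun z s (τ K) = blockFun r t (fun k => τ (k + 1) - τ k) K := by
  have key : ∀ k ≤ K, endFun z s (τ k) = blockFun r t (fun k => τ (k + 1) - τ k) k := by
    intro k
    induction k with
    | zero =>
      intro h
      rw [blockFun, ← hzr 0 (by omega), hτ0]; rfl
    | succ k ih =>
      intro h
      have h1 := hτ k (by omega)
      obtain ⟨i, hi⟩ : ∃ i, τ (k + 1) = τ k + (i + 1) := ⟨τ (k + 1) - τ k - 1, by omega⟩
      have h2 := endFun_add (z := z) (s := s) (s₀ := t k) (τ k) i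
        (fun j hj hj' => hz k (by omega) j hj (by omega))
        (fun j hj hj' => hs k (by omega) j hj (by omega))
      rw [← hi, hzr _ h, ih (by omega)] at h2
      rw [h2, blockFun]
      have : τ (k + 1) - τ k = i + 1 := by omega
      simp only [this]
  exact key K le_rfl

/-! ### The exponential moment as a block function -/

/-- Ratio of the geometric weight of the altitude at the `k`-th marked time. -/
noncomputable def endRatio {n : ℕ} (ρ₀ ρ₁ : ℝ) (q : Fin (n + 2) → ℝ) (k : Fin (n + 2)) : ℝ :=
  (if k = 0 then ρ₀ else 1) * (if k = Fin.last (n + 1) then ρ₁ else 1) * rexp (-q k)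

theorem Finset.prod_ite_pow_eq {L : ℕ} (γ : Fin (L + 1) → ℕ) (i : Fin (L + 1)) (b : ℝ) :
    ∏ j : Fin (L + 1), (if i = j then b else 1) ^ γ j = b ^ γ i := by
  rw [Finset.prod_eq_single i]
  · simp
  · intro j _ h; simp [h.symm]
  · simp

section

variable {a c σ : ℝ} {n L : ℕ} {x : Fin (n + 2) → ℝ} {τ : Fin (n + 2) → ℕ}

/-- The weight of the altitude at time `j`, as a product over the marked times `τ k`. -/
noncomputable def markedRatio (τ : Fin (n + 2) → ℕ) (r : Fin (n + 2) → ℝ) (j : ℕ) : ℝ :=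
  ∏ k, if τ k = j then r k else 1

/-- The weight of a horizontal step from `j` to `j + 1` tilted by `θ`. -/
noncomputable def markedTilt (σ : ℝ) (τ : Fin (n + 2) → ℕ) (θ : Fin (n + 1) → ℝ) (j : ℕ) : ℝ :=
  σ * rexp (∑ k : Fin (n + 1), if j + 1 ≤ τ k.succ then θ k else 0)

theorem prod_markedRatio (γ : Fin (L + 1) → ℕ) (hτ : ∀ k, τ k ≤ L) (r : Fin (n + 2) → ℝ) :
    ∏ j : Fin (L + 1), markedRatio τ r j ^ γ j =
      ∏ k, r k ^ γ ⟨τ k, Nat.lt_succ_of_le (hτ k)⟩ := by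
  simp_rw [markedRatio, ← Finset.prod_pow]
  rw [Finset.prod_comm]
  refine Finset.prod_congr rfl fun k _ => ?_
  rw [← Finset.prod_ite_pow_eq γ ⟨τ k, Nat.lt_succ_of_le (hτ k)⟩ (r k)]
  refine Finset.prod_congr rfl fun j _ => ?_
  simp [Fin.ext_iff]

theorem markedRatio_apply (hτ : StrictMono τ) (r : Fin (n + 2) → ℝ) (k : Fin (n + 2)) :
    markedRatio τ r (τ k) = r k := by
  rw [markedRatio, Finset.prod_eq_single k]
  · simp
  · intro j _ h; rw [if_neg (hτ.injective.ne h)]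
  · simp

theorem markedRatio_of_mem_Ioo (hτ : StrictMono τ) (r : Fin (n + 2) → ℝ) (k : Fin (n + 1)) {j : ℕ}
    (h1 : τ k.castSucc < j) (h2 : j < τ k.succ) : markedRatio τ r j = 1 := by
  refine Finset.prod_eq_one fun i _ => if_neg fun h => ?_
  rw [← h] at h1 h2
  have h1 := hτ.lt_iff_lt.1 h1
  have h2 := hτ.lt_iff_lt.1 h2
  rw [Fin.lt_def] at h1 h2
  simp at h1 h2
  omega

/-- A step in block `k` lies before the mark `τ i.succ` exactly when `i ≥ k`, which is where the
tail sums s̃_k come from. -/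
theorem markedTilt_of_mem_Ico (hτ : StrictMono τ) (θ : Fin (n + 1) → ℝ) (k : Fin (n + 1)) {j : ℕ}
    (h1 : τ k.castSucc ≤ j) (h2 : j < τ k.succ) :
    markedTilt σ τ θ j = σ * rexp (∑ i ∈ Finset.Ici k, θ i) := by
  rw [markedTilt, ← Finset.sum_filter]
  congr 3
  ext i
  simp only [Finset.mem_filter, Finset.mem_univ, true_and, Finset.mem_Ici]
  constructor
  · intro h
    by_contra! hik
    have : τ i.succ ≤ τ k.castSucc := hτ.monotone (by
      rw [Fin.lt_def] at hik; rw [Fin.le_def]; simp; omega)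
    omega
  · intro h
    have : τ k.succ ≤ τ i.succ := hτ.monotone (by simpa using h)
    omega

theorem stepWeight_prod_eq (γ : MotzkinPath L) (s : ℕ → ℝ) :
    ∏ j : Fin L, stepWeight (s j) (γ.1 j.castSucc) (γ.1 j.succ) =
      ∏ j : Fin L, s j ^ γ.epsZero j := by
  refine Finset.prod_congr rfl fun j _ => ?_
  unfold stepWeight MotzkinPath.epsZero
  split_ifs with h1 h2
  · simp
  · simp
  · exfalso
    have := γ.2 j
    rw [abs_le] at this
    omega

/-- Allows the sum over Motzkin paths to be extended to all sequences of altitudes. -/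
theorem pathWeight_eq_zero (z s : ℕ → ℝ) {γ : Fin (L + 1) → ℕ}
    (h : ¬ ∀ k : Fin L, |(γ k.succ : ℤ) - (γ k.castSucc : ℤ)| ≤ 1) : pathWeight z s L γ = 0 := by
  push Not at h
  obtain ⟨k, hk⟩ := h
  refine mul_eq_zero_of_right _ (Finset.prod_eq_zero (Finset.mem_univ k) ?_)
  rw [lt_abs] at hk
  unfold stepWeight
  rw [if_neg (by omega), if_neg (by omega)]

theorem prod_endRatio_pow (ρ₀ ρ₁ : ℝ) (q : Fin (n + 2) → ℝ) (h : Fin (n + 2) → ℕ) :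
    ∏ k, endRatio ρ₀ ρ₁ q k ^ h k =
      ρ₀ ^ h 0 * ρ₁ ^ h (Fin.last (n + 1)) * rexp (-∑ k, q k * h k) := by
  simp_rw [endRatio, mul_pow, Finset.prod_mul_distrib]
  congr 2
  · rw [Finset.prod_eq_single 0]
    · simp
    · intro j _ hj; simp [hj]
    · simp
  · rw [Finset.prod_eq_single (Fin.last (n + 1))]
    · simp
    · intro j _ hj; simp [hj]
    · simp
  · rw [← Finset.sum_neg_distrib, Real.exp_sum]
    refine Finset.prod_congr rfl fun k _ => ?_
    rw [← Real.exp_nat_mul]; congr 1; ring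

theorem prod_markedTilt_pow (γ : MotzkinPath L) (θ : Fin (n + 1) → ℝ)
    (hτ : ∀ k, τ k = ⌊(L : ℝ) * x k⌋₊) :
    ∏ j : Fin L, markedTilt σ τ θ j ^ γ.epsZero j =
      γ.edgeWeight σ * rexp (∑ k : Fin (n + 1), θ k * γ.horizontal (x k.succ)) := by
  simp_rw [markedTilt, mul_pow, Finset.prod_mul_distrib]
  rw [Finset.prod_pow_eq_pow_sum, MotzkinPath.edgeWeight]
  congr 1
  simp_rw [← Real.exp_nat_mul, ← Real.exp_sum]
  congr 1
  simp_rw [Finset.mul_sum]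
  rw [Finset.sum_comm]
  refine Finset.sum_congr rfl fun k _ => ?_
  rw [MotzkinPath.horizontal, Nat.cast_sum, Finset.mul_sum, Finset.sum_filter]
  refine Finset.sum_congr rfl fun j _ => ?_
  rw [hτ]
  split_ifs <;> ring

/-- Everything random factors over vertices and steps; the centring is deterministic and comes out
as a prefactor. -/
theorem weight_mul_motzkinExp_eq (γ : MotzkinPath L) (q : Fin (n + 2) → ℝ) (θ : Fin (n + 1) → ℝ)
    (hτ : ∀ k, τ k = ⌊(L : ℝ) * x k⌋₊) (hm : StrictMono τ) (h0 : τ 0 = 0)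
    (hL : τ (Fin.last (n + 1)) = L) :
    γ.weight a c σ * motzkinExp σ x L q θ γ =
      rexp (-(σ / (2 + σ) * ∑ k : Fin (n + 1), θ k * τ k.succ)) *
        pathWeight (markedRatio τ (endRatio (1 - c / √L) (1 - a / √L) q)) (markedTilt σ τ θ) L
          γ.1 := by
  have hle : ∀ k, τ k ≤ L := fun k => hL ▸ hm.monotone (Fin.le_last k)
  have hh : ∀ k, γ.1 ⟨τ k, Nat.lt_succ_of_le (hle k)⟩ = γ.height ⌊(L : ℝ) * x k⌋₊ := fun k => by
    rw [← hτ, MotzkinPath.height]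
    simp [hle k]
  rw [pathWeight, stepWeight_prod_eq, prod_markedTilt_pow γ θ hτ, prod_markedRatio γ.1 hle,
    prod_endRatio_pow]
  have e0 : γ.1 ⟨τ 0, Nat.lt_succ_of_le (hle 0)⟩ = γ.height 0 := by rw [hh, ← hτ, h0]
  have e1 : γ.1 ⟨τ (Fin.last (n + 1)), Nat.lt_succ_of_le (hle _)⟩ = γ.height L := by
    rw [hh, ← hτ, hL]
  rw [e0, e1]
  simp_rw [hh]
  have : motzkinExp σ x L q θ γ =
      rexp (-(σ / (2 + σ) * ∑ k : Fin (n + 1), θ k * τ k.succ)) *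
        rexp (-∑ k, q k * (γ.height ⌊(L : ℝ) * x k⌋₊ : ℝ)) *
          rexp (∑ k : Fin (n + 1), θ k * γ.horizontal (x k.succ)) := by
    rw [motzkinExp, ← Real.exp_add, ← Real.exp_add]
    congr 1
    have : ∑ k : Fin (n + 1), θ k * γ.centredHorizontal σ (x k.succ) =
        ∑ k : Fin (n + 1), θ k * γ.horizontal (x k.succ) -
          σ / (2 + σ) * ∑ k : Fin (n + 1), θ k * τ k.succ := by
      rw [Finset.mul_sum, ← Finset.sum_sub_distrib]
      refine Finset.sum_congr rfl fun k _ => ?_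
      rw [MotzkinPath.centredHorizontal, hτ]; ring
    rw [this]; ring
  rw [this, MotzkinPath.weight]
  ring

theorem tsum_weight_mul_motzkinExp (hσ : 0 ≤ σ) (hc : 0 ≤ 1 - c / √(L : ℝ))
    (ha : 0 ≤ 1 - a / √(L : ℝ)) (q : Fin (n + 2) → ℝ) (θ : Fin (n + 1) → ℝ)
    (hτ : ∀ k, τ k = ⌊(L : ℝ) * x k⌋₊) (hm : StrictMono τ) (h0 : τ 0 = 0)
    (hL : τ (Fin.last (n + 1)) = L) :
    ∑' γ : MotzkinPath L, ENNReal.ofReal (γ.weight a c σ * motzkinExp σ x L q θ γ) =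
      ENNReal.ofReal (rexp (-(σ / (2 + σ) * ∑ k : Fin (n + 1), θ k * τ k.succ))) *
        ∑' m, ENNReal.ofReal (blockFun
          (fun k => endRatio (1 - c / √L) (1 - a / √L) q (Fin.ofNat (n + 2) k))
          (fun k => σ * rexp (∑ i ∈ Finset.Ici (Fin.ofNat (n + 1) k), θ i))
          (fun k => τ (Fin.ofNat (n + 2) (k + 1)) - τ (Fin.ofNat (n + 2) k)) (n + 1) m) := by
  set z := markedRatio τ (endRatio (1 - c / √L) (1 - a / √L) q) with hz
  set s := markedTilt σ τ θ with hs
  have hz0 : ∀ j, 0 ≤ z j := fun j => Finset.prod_nonneg fun k _ => by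
    split_ifs
    · unfold endRatio
      refine mul_nonneg (mul_nonneg ?_ ?_) (Real.exp_pos _).le
      · split_ifs <;> [exact hc; exact zero_le_one]
      · split_ifs <;> [exact ha; exact zero_le_one]
    · exact zero_le_one
  have hs0 : ∀ j, 0 ≤ s j := fun j => mul_nonneg hσ (Real.exp_pos _).le
  simp_rw [weight_mul_motzkinExp_eq _ q θ hτ hm h0 hL, ENNReal.ofReal_mul (Real.exp_pos _).le,
    ENNReal.tsum_mul_left]
  congr 1
  have h1 := tsum_subtype_eq_of_support_subset (f := fun γ : Fin (L + 1) → ℕ =>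
    ENNReal.ofReal (pathWeight z s L γ))
    (s := {γ | ∀ k : Fin L, |(γ k.succ : ℤ) - (γ k.castSucc : ℤ)| ≤ 1}) (by
      intro γ hγ
      by_contra h
      exact hγ (by simp [pathWeight_eq_zero z s h]))
  refine h1.trans ?_
  have h2 := tsum_pathWeight hz0 hs0 L 1
  simp only [Pi.one_apply, mul_one] at h2
  rw [h2]
  -- `blockFun` takes sequences indexed by ℕ, so the finite data are extended by `Fin.ofNat`. The
  -- values produced by wrap-around never enter `n + 1` blocks.
  have hcs : ∀ k < n + 1, ∃ i : Fin (n + 1), Fin.ofNat (n + 1) k = i ∧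
      Fin.ofNat (n + 2) k = i.castSucc ∧ Fin.ofNat (n + 2) (k + 1) = i.succ := fun k hk =>
    ⟨⟨k, hk⟩, by ext; simp [Nat.mod_eq_of_lt hk], by
      ext; simp; omega, by ext; simp; omega⟩
  have hlast : Fin.ofNat (n + 2) (n + 1) = Fin.last (n + 1) := by ext; simp
  have h3 := endFun_eq_blockFun (z := z) (s := s)
    (r := fun k => endRatio (1 - c / √L) (1 - a / √L) q (Fin.ofNat (n + 2) k))
    (t := fun k => σ * rexp (∑ i ∈ Finset.Ici (Fin.ofNat (n + 1) k), θ i))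
    (τ := fun k => τ (Fin.ofNat (n + 2) k)) (K := n + 1) (by simpa using h0)
    (fun k hk => by
      obtain ⟨i, _, h, h'⟩ := hcs k hk
      simp only [h, h']; exact hm i.castSucc_lt_succ)
    (fun k hk => markedRatio_apply hm _ _)
    (fun k hk j hj hj' => by
      obtain ⟨i, _, h, h'⟩ := hcs k hk
      simp only [h, h'] at hj hj'
      exact markedRatio_of_mem_Ioo hm _ i hj hj')
    (fun k hk j hj hj' => by
      obtain ⟨i, h'', h, h'⟩ := hcs k hk
      simp only [h, h'] at hj hj'
      simp only [h'']
      exact markedTilt_of_mem_Ico hm _ i hj hj')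
  simp only [hlast, hL] at h3
  rw [h3]

end

/-! ### The sine basis in the rescaled spectral variable -/

/-- The angle `√(u / L)`. -/
noncomputable def angle (L : ℕ) (u : ℝ) : ℝ := √u / √(L : ℝ)

/-- The density for which the functions `sin ((m + 1) √(u / L))` are orthonormal on `(0, ∞)`. -/
noncomputable def angleDensity (L : ℕ) (u : ℝ) : ℝ :=
  if angle L u < π then 1 / (π * √u * √(L : ℝ)) else 0

theorem measurable_angle (L : ℕ) : Measurable (angle L) := by unfold angle; fun_prop

theorem angle_nonneg (L : ℕ) (u : ℝ) : 0 ≤ angle L u := by unfold angle; positivity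

theorem measurable_angleDensity (L : ℕ) : Measurable (angleDensity L) := by
  unfold angleDensity
  exact Measurable.ite (measurableSet_lt (measurable_angle L) measurable_const) (by fun_prop)
    measurable_const

theorem integral_cos_int_mul (k : ℤ) :
    ∫ y in (0 : ℝ)..π, cos (k * y) = if k = 0 then π else 0 := by
  split_ifs with h
  · simp [h]
  · have hk : (k : ℝ) ≠ 0 := by exact_mod_cast h
    rw [intervalIntegral.integral_comp_mul_left _ hk, integral_cos]
    simp [Real.sin_int_mul_pi]

theorem integral_sin_mul_sin (m l : ℕ) :
    ∫ y in (0 : ℝ)..π, sin ((m + 1) * y) * sin ((l + 1) * y) = if l = m then π / 2 else 0 := by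
  have e : ∀ y : ℝ, sin ((m + 1) * y) * sin ((l + 1) * y) =
      (1 / 2) * (cos (((m - l : ℤ) : ℝ) * y) - cos (((m + l + 2 : ℤ) : ℝ) * y)) := fun y => by
    have h1 : ((m - l : ℤ) : ℝ) * y = (m + 1) * y - (l + 1) * y := by push_cast; ring
    have h2 : ((m + l + 2 : ℤ) : ℝ) * y = (m + 1) * y + (l + 1) * y := by push_cast; ring
    rw [h1, h2, cos_sub, cos_add]; ring
  simp_rw [e]
  rw [intervalIntegral.integral_const_mul, intervalIntegral.integral_sub
    (Continuous.intervalIntegrable (by fun_prop) _ _)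
    (Continuous.intervalIntegrable (by fun_prop) _ _), integral_cos_int_mul, integral_cos_int_mul,
    if_neg (by omega : ¬ ((m : ℤ) + l + 2 = 0))]
  by_cases h : l = m
  · subst h; simp; ring
  · rw [if_neg h, if_neg (by omega)]; simp

/-- Substitution y = √u / √L, for which (2/π) dy = du / (π √u √L); the cutoff in the density
corresponds to y < π. -/
theorem integral_angleDensity_mul {L : ℕ} (hL : 0 < L) (F : ℝ → ℝ) :
    ∫ u in Ioi (0 : ℝ), angleDensity L u * F (angle L u) = 2 / π * ∫ y in (0 : ℝ)..π, F y := by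
  have hs : 0 < √(L : ℝ) := by positivity
  set g : ℝ → ℝ := (Iio π).indicator F with hg
  have h1 := integral_comp_rpow_Ioi_of_pos (g := fun y => (2 / (π * √(L : ℝ))) * g ((√L)⁻¹ * y))
    (p := 1 / 2) (by norm_num)
  rw [integral_const_mul, integral_comp_mul_left_Ioi g 0 (inv_pos.2 hs)] at h1
  have h2 : ∫ y in Ioi (0 : ℝ), g y = ∫ y in (0 : ℝ)..π, F y := by
    rw [hg, setIntegral_indicator measurableSet_Iio, intervalIntegral.integral_of_le pi_pos.le,
      ← integral_Ioc_eq_integral_Ioo.symm]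
    rfl
  rw [mul_zero, h2] at h1
  rw [show 2 / π * ∫ y in (0 : ℝ)..π, F y =
    2 / (π * √(L : ℝ)) * (√(L : ℝ))⁻¹⁻¹ • ∫ y in (0 : ℝ)..π, F y by
      simp only [smul_eq_mul, inv_inv]; field_simp, ← h1]
  refine setIntegral_congr_fun measurableSet_Ioi fun u hu => ?_
  have hu : 0 < u := hu
  have hsu : 0 < √u := sqrt_pos.2 hu
  have e1 : u ^ (1 / 2 - 1 : ℝ) = 1 / √u := by
    rw [Real.rpow_sub hu, Real.rpow_one, ← Real.sqrt_eq_rpow, div_eq_div_iff hu.ne' hsu.ne',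
      one_mul, Real.mul_self_sqrt hu.le]
  have e2 : (√(L : ℝ))⁻¹ * √u = angle L u := by unfold angle; field_simp
  simp only [smul_eq_mul]
  rw [← Real.sqrt_eq_rpow, e2, e1, hg, angleDensity]
  by_cases h : angle L u < π
  · rw [if_pos h, indicator_of_mem (show angle L u ∈ Iio π from h)]; field_simp
  · rw [if_neg h, indicator_of_notMem (show angle L u ∉ Iio π from h)]; simp

theorem integrableOn_exp_div_sqrt {κ : ℝ} (hκ : 0 < κ) :
    IntegrableOn (fun u => rexp (-κ * u) / √u) (Ioi 0) := by
  refine (integrableOn_rpow_mul_exp_neg_mul_rpow (s := -(1 / 2)) (p := 1) (b := κ) (by norm_num)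
    one_pos hκ).congr_fun (fun u hu => ?_) measurableSet_Ioi
  simp only
  rw [Real.rpow_neg (le_of_lt hu), ← Real.sqrt_eq_rpow, Real.rpow_one]
  field_simp

theorem angleDensity_nonneg (L : ℕ) (u : ℝ) : 0 ≤ angleDensity L u := by
  unfold angleDensity; split_ifs <;> positivity

theorem angle_sq {L : ℕ} {u : ℝ} (hu : 0 ≤ u) : angle L u ^ 2 = u / L := by
  rw [angle, div_pow, Real.sq_sqrt hu, Real.sq_sqrt (Nat.cast_nonneg L)]

theorem isSineBasis_angle {L : ℕ} (hL : 0 < L) :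
    IsSineBasis (angleDensity L) (angle L) (volume.restrict (Ioi 0)) where
  measurable_angle := measurable_angle L
  integrable_weight := by
    have hL' : (0 : ℝ) < L := by exact_mod_cast hL
    -- On the support u ≤ π² L, hence 1 ≤ exp(π² L) exp(-u), and the integrable function exp(-u)/√u
    -- dominates.
    refine ((integrableOn_exp_div_sqrt one_pos).const_mul
      (rexp (π ^ 2 * L) / (π * √(L : ℝ)))).mono' (measurable_angleDensity L).aestronglyMeasurable ?_
    refine (ae_restrict_mem measurableSet_Ioi).mono fun u hu => ?_
    have hu : 0 < u := hu
    have hsu : 0 < √u := sqrt_pos.2 hu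
    rw [Real.norm_of_nonneg (angleDensity_nonneg L u), angleDensity]
    split_ifs with h
    · have h1 : angle L u ^ 2 ≤ π ^ 2 := pow_le_pow_left₀ (angle_nonneg L u) h.le 2
      rw [angle_sq hu.le, div_le_iff₀ hL'] at h1
      have h2 : 1 ≤ rexp (π ^ 2 * L) * rexp (-1 * u) := by
        rw [← Real.exp_add]; exact Real.one_le_exp (by linarith)
      have : rexp (π ^ 2 * L) / (π * √(L : ℝ)) * (rexp (-1 * u) / √u) =
          (rexp (π ^ 2 * L) * rexp (-1 * u)) / (π * √u * √(L : ℝ)) := by field_simp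
      rw [this]
      gcongr
    · positivity
  orthonormal m l := by
    rw [integral_angleDensity_mul hL fun y => sin ((m + 1) * y) * sin ((l + 1) * y),
      integral_sin_mul_sin]
    split_ifs
    · field_simp
    · simp

/-! ### Asymptotics and bounds at scale `√L` -/

theorem tendsto_inv_sqrt_natCast : Tendsto (fun L : ℕ => (√(L : ℝ))⁻¹) atTop (𝓝 0) :=
  tendsto_inv_atTop_zero.comp (Real.tendsto_sqrt_atTop.comp tendsto_natCast_atTop_atTop)

theorem tendsto_div_sqrt_natCast (v : ℝ) : Tendsto (fun L : ℕ => v / √(L : ℝ)) atTop (𝓝 0) := by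
  simpa [div_eq_mul_inv] using tendsto_inv_sqrt_natCast.const_mul v

theorem tendsto_sqrt_mul_sin (v : ℝ) :
    Tendsto (fun L : ℕ => √(L : ℝ) * sin (v / √(L : ℝ))) atTop (𝓝 v) := by
  have h := ((Real.continuous_sinc.tendsto 0).comp (tendsto_div_sqrt_natCast v)).const_mul v
  rw [Real.sinc_zero, mul_one] at h
  refine h.congr' ?_
  filter_upwards [eventually_gt_atTop 0] with L hL
  have hs : 0 < √(L : ℝ) := by positivity
  rcases eq_or_ne v 0 with rfl | hv
  · simp
  · simp only [Function.comp_apply]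
    rw [Real.sinc_of_ne_zero (div_ne_zero hv hs.ne')]
    field_simp

theorem tendsto_mul_one_sub_cos (v : ℝ) :
    Tendsto (fun L : ℕ => (L : ℝ) * (1 - cos (v / √(L : ℝ)))) atTop (𝓝 (v ^ 2 / 2)) := by
  have h := ((tendsto_sqrt_mul_sin (v / 2)).pow 2).const_mul 2
  rw [show 2 * (v / 2) ^ 2 = v ^ 2 / 2 by ring] at h
  refine h.congr fun L => ?_
  have e : cos (v / √(L : ℝ)) = 1 - 2 * sin (v / 2 / √(L : ℝ)) ^ 2 := by
    rw [show v / √(L : ℝ) = 2 * (v / 2 / √(L : ℝ)) by ring, Real.cos_two_mul, Real.cos_sq']; ring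
  rw [e, mul_pow, Real.sq_sqrt (Nat.cast_nonneg L)]; ring

theorem tendsto_one_of_tendsto_sqrt_mul {r : ℕ → ℝ} {t : ℝ}
    (h : Tendsto (fun L : ℕ => √(L : ℝ) * (1 - r L)) atTop (𝓝 t)) : Tendsto r atTop (𝓝 1) := by
  have h1 := (tendsto_inv_sqrt_natCast.mul h).const_sub 1
  rw [zero_mul, sub_zero] at h1
  refine h1.congr' ?_
  filter_upwards [eventually_gt_atTop 0] with L hL
  have hs : √(L : ℝ) ≠ 0 := by positivity
  field_simp; ring

/-- The denominator equals (1 - r)² + 2r(1 - cos), and both terms are of order 1/L. -/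
theorem tendsto_mul_poissonDenom {r : ℕ → ℝ} {t : ℝ}
    (h : Tendsto (fun L : ℕ => √(L : ℝ) * (1 - r L)) atTop (𝓝 t)) (v : ℝ) :
    Tendsto (fun L : ℕ => (L : ℝ) * (1 - 2 * r L * cos (v / √(L : ℝ)) + r L ^ 2)) atTop
      (𝓝 (t ^ 2 + v ^ 2)) := by
  have h1 := (h.pow 2).add
    (((tendsto_one_of_tendsto_sqrt_mul h).mul (tendsto_mul_one_sub_cos v)).const_mul 2)
  rw [show t ^ 2 + 2 * (1 * (v ^ 2 / 2)) = t ^ 2 + v ^ 2 by ring] at h1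
  refine h1.congr fun L => ?_
  rw [mul_pow, Real.sq_sqrt (Nat.cast_nonneg L)]; ring

theorem tendsto_sinGen_div_sqrt {r : ℕ → ℝ} {t : ℝ} (ht : 0 < t)
    (h : Tendsto (fun L : ℕ => √(L : ℝ) * (1 - r L)) atTop (𝓝 t)) {u : ℝ} (hu : 0 ≤ u) :
    Tendsto (fun L : ℕ => sinGen (r L) (angle L u) / √(L : ℝ)) atTop (𝓝 (√u / (t ^ 2 + u))) := by
  have h1 := (tendsto_sqrt_mul_sin √u).div (tendsto_mul_poissonDenom h √u) (by positivity)
  rw [Real.sq_sqrt hu] at h1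
  refine h1.congr' ?_
  filter_upwards [eventually_gt_atTop 0] with L hL
  have hs : √(L : ℝ) ≠ 0 := by positivity
  simp only [Pi.div_apply, sinGen, angle]
  nth_rewrite 3 [← Real.mul_self_sqrt (Nat.cast_nonneg L)]
  rw [mul_assoc, mul_div_mul_left _ _ hs, div_div, mul_comm (√(L : ℝ))]

/-- The numerator of `sinKer` is of order L^{-3/2} and the denominator of order L^{-2}. The limit is
recognized from (t² + (√u - √v)²)(t² + (√u + √v)²) = t⁴ + (v - u)² + 2(v + u)t². -/
theorem tendsto_sinKer_div_sqrt {r : ℕ → ℝ} {t : ℝ} (ht : 0 < t)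
    (h : Tendsto (fun L : ℕ => √(L : ℝ) * (1 - r L)) atTop (𝓝 t)) {u v : ℝ} (hu : 0 ≤ u)
    (hv : 0 ≤ v) :
    Tendsto (fun L : ℕ => sinKer (r L) (angle L u) (angle L v) / √(L : ℝ)) atTop
      (𝓝 (π * √u * bianeKernel t u v)) := by
  have h0 : Tendsto (fun L : ℕ => √(L : ℝ) * (1 - r L ^ 2)) atTop (𝓝 (t * (1 + 1))) := by
    refine (h.mul ((tendsto_one_of_tendsto_sqrt_mul h).const_add 1)).congr fun L => by ring
  have h1 := (h0.mul ((tendsto_sqrt_mul_sin √u).mul (tendsto_sqrt_mul_sin √v))).div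
    ((tendsto_mul_poissonDenom h (√u - √v)).mul (tendsto_mul_poissonDenom h (√u + √v)))
    (by positivity)
  have e : t * (1 + 1) * (√u * √v) / ((t ^ 2 + (√u - √v) ^ 2) * (t ^ 2 + (√u + √v) ^ 2)) =
      π * √u * bianeKernel t u v := by
    have : (t ^ 2 + (√u - √v) ^ 2) * (t ^ 2 + (√u + √v) ^ 2) =
        t ^ 4 + (v - u) ^ 2 + 2 * (v + u) * t ^ 2 := by
      have hu' := Real.sq_sqrt hu
      have hv' := Real.sq_sqrt hv
      generalize √u = y at *
      generalize √v = y' at *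
      subst hu' hv'
      ring
    rw [this, bianeKernel]
    field_simp
    ring
  rw [e] at h1
  refine h1.congr' ?_
  filter_upwards [eventually_gt_atTop 0] with L hL
  have hs : √(L : ℝ) ≠ 0 := by positivity
  have hL : (L : ℝ) = √(L : ℝ) ^ 2 := (Real.sq_sqrt (Nat.cast_nonneg L)).symm
  simp only [Pi.div_apply, sinKer, angle, ← sub_div, ← add_div]
  set D₁ := 1 - 2 * r L * cos ((√u - √v) / √(L : ℝ)) + r L ^ 2
  set D₂ := 1 - 2 * r L * cos ((√u + √v) / √(L : ℝ)) + r L ^ 2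
  set S₁ := sin (√u / √(L : ℝ))
  set S₂ := sin (√v / √(L : ℝ))
  have e1 : √(L : ℝ) * (1 - r L ^ 2) * (√(L : ℝ) * S₁ * (√(L : ℝ) * S₂)) =
      √(L : ℝ) ^ 3 * ((1 - r L ^ 2) * (S₁ * S₂)) := by ring
  have e2 : (L : ℝ) * D₁ * (L * D₂) = √(L : ℝ) ^ 3 * (D₁ * D₂ * √(L : ℝ)) := by
    nth_rewrite 1 2 [hL]; ring
  rw [e1, e2, mul_div_mul_left _ _ (pow_ne_zero 3 hs), div_div]

theorem tendsto_sqrt_mul_angleDensity {u : ℝ} (hu : 0 < u) :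
    Tendsto (fun L : ℕ => √(L : ℝ) * angleDensity L u) atTop (𝓝 (1 / (π * √u))) := by
  refine tendsto_const_nhds.congr' ?_
  have h := (tendsto_div_sqrt_natCast √u).eventually (gt_mem_nhds pi_pos)
  filter_upwards [h, eventually_gt_atTop 0] with L h hL
  have hs : √(L : ℝ) ≠ 0 := by positivity
  have hsu : 0 < √u := sqrt_pos.2 hu
  rw [angleDensity, if_pos (show angle L u < π from h)]
  field_simp

theorem sqrt_mul_angleDensity_le (L : ℕ) (u : ℝ) : √(L : ℝ) * angleDensity L u ≤ 1 / √u := by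
  unfold angleDensity
  split_ifs with h
  · rcases eq_or_ne (√(L : ℝ)) 0 with h0 | h0
    · rw [h0]; simp
    rcases eq_or_ne (√u) 0 with h1 | h1
    · rw [h1]; simp
    have : √(L : ℝ) * (1 / (π * √u * √(L : ℝ))) = 1 / (π * √u) := by field_simp
    rw [this]
    have : 0 < √u := lt_of_le_of_ne (sqrt_nonneg _) h1.symm
    gcongr
    have := Real.two_le_pi
    nlinarith
  · simp

theorem tendsto_mul_exp_sub (y : ℝ) :
    Tendsto (fun L : ℕ => (L : ℝ) * (rexp (y / √(L : ℝ)) - 1 - y / √(L : ℝ))) atTop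
      (𝓝 (y ^ 2 / 2)) := by
  rw [tendsto_iff_dist_tendsto_zero]
  -- 4/18 is the constant of the cubic remainder in `Real.exp_bound` with n = 3.
  have h0 := (tendsto_div_sqrt_natCast (|y| ^ 3 * (4 / 18)))
  refine squeeze_zero' (.of_forall fun _ => dist_nonneg) ?_ h0
  have h1 := (tendsto_div_sqrt_natCast |y|).eventually (gt_mem_nhds one_pos)
  filter_upwards [h1, eventually_gt_atTop 0] with L h1 hL
  have hs : 0 < √(L : ℝ) := by positivity
  have hL : (L : ℝ) = √(L : ℝ) ^ 2 := (Real.sq_sqrt (Nat.cast_nonneg L)).symm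
  have h2 := Real.exp_bound (x := y / √(L : ℝ)) (by rw [abs_div, abs_of_pos hs]; exact h1.le)
    (n := 3) (by norm_num)
  rw [Finset.sum_range_succ, Finset.sum_range_succ, Finset.sum_range_one] at h2
  simp only [pow_zero, pow_one, Nat.factorial] at h2
  norm_num at h2
  rw [Real.dist_eq]
  have e : (L : ℝ) * (rexp (y / √(L : ℝ)) - 1 - y / √(L : ℝ)) - y ^ 2 / 2 =
      L * (rexp (y / √(L : ℝ)) - (1 + y / √(L : ℝ) + (y / √(L : ℝ)) ^ 2 / 2)) := by
    have : y ^ 2 / 2 = L * ((y / √(L : ℝ)) ^ 2 / 2) := by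
      nth_rewrite 1 [hL]; field_simp
    rw [this]; ring
  rw [e, abs_mul, Nat.abs_cast]
  refine (mul_le_mul_of_nonneg_left h2 (Nat.cast_nonneg L)).trans_eq ?_
  rw [abs_div, abs_of_pos hs]
  nth_rewrite 1 [hL]
  field_simp
  ring

theorem tendsto_sqrt_mul_exp_sub_one (y : ℝ) :
    Tendsto (fun L : ℕ => √(L : ℝ) * (rexp (y / √(L : ℝ)) - 1)) atTop (𝓝 y) := by
  have h := ((tendsto_inv_sqrt_natCast.mul (tendsto_mul_exp_sub y)).add_const y)
  rw [zero_mul, zero_add] at h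
  refine h.congr' ?_
  filter_upwards [eventually_gt_atTop 0] with L hL
  have hs : √(L : ℝ) ≠ 0 := by positivity
  have hL : (L : ℝ) = √(L : ℝ) ^ 2 := (Real.sq_sqrt (Nat.cast_nonneg L)).symm
  nth_rewrite 2 [hL]
  field_simp
  ring

/-- The base differs from 1 by -2(1 - cos)/(2 + s), which is of order 1/L, while N is asymptotic to
ΔL. -/
theorem tendsto_cos_pow {σ Δ : ℝ} (hσ : 0 < σ) {s : ℕ → ℝ} (hs : Tendsto s atTop (𝓝 σ))
    {N : ℕ → ℕ} (hN : Tendsto (fun L => (N L : ℝ) / L) atTop (𝓝 Δ)) (v : ℝ) :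
    Tendsto (fun L : ℕ => ((s L + 2 * cos (v / √(L : ℝ))) / (2 + s L)) ^ N L) atTop
      (𝓝 (rexp (-(1 / (2 + σ)) * (Δ * v ^ 2)))) := by
  have h2 : Tendsto (fun L => 2 + s L) atTop (𝓝 (2 + σ)) := hs.const_add 2
  have hpos : (2 + σ) ≠ 0 := by positivity
  have hcos : Tendsto (fun L : ℕ => cos (v / √(L : ℝ))) atTop (𝓝 1) := by
    simpa [Function.comp_def] using (Real.continuous_cos.tendsto 0).comp (tendsto_div_sqrt_natCast v)
  refine tendsto_pow_exp ?_ ?_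
  · have h := (hs.add (hcos.const_mul 2)).div h2 hpos
    have e : (σ + 2 * 1) / (2 + σ) = 1 := by rw [div_eq_one_iff_eq hpos]; ring
    rwa [e] at h
  · have h := ((hN.mul (tendsto_mul_one_sub_cos v)).const_mul (-2)).div h2 hpos
    rw [show -2 * (Δ * (v ^ 2 / 2)) / (2 + σ) = -(1 / (2 + σ)) * (Δ * v ^ 2) by ring] at h
    refine h.congr' ?_
    filter_upwards [eventually_gt_atTop 0, h2.eventually (lt_mem_nhds (by positivity : 0 < 2 + σ))]
      with L hL h2
    have hL : (L : ℝ) ≠ 0 := by positivity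
    simp only [Pi.div_apply]
    field_simp
    ring

/-- The base is 1 - y with y = 2(1 - cos φ)/(2 + s), and it may be negative near φ = π. Positive
weight of the horizontal steps (aperiodicity) keeps it away from -1: y ≤ 4/(2 + σ/2) gives y(1 + κ)
≤ 2 when κ ≤ σ/4. With κ ≤ 1 this yields |1 - y| ≤ 1 - κy ≤ exp(-κy), and y is at least a multiple
of φ². -/
theorem abs_cos_pow_le {σ s : ℝ} (hσ : 0 < σ) (hs : σ / 2 ≤ s) (hs' : s ≤ 2 * σ) {φ : ℝ}
    (hφ : |φ| ≤ π) (N : ℕ) :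
    |((s + 2 * cos φ) / (2 + s)) ^ N| ≤
      rexp (-(4 / π ^ 2 * min 1 (σ / 4) / (2 + 2 * σ)) * (N * φ ^ 2)) := by
  have hs0 : 0 < s := by linarith
  set κ := min 1 (σ / 4) with hκ
  have hκ0 : 0 < κ := lt_min one_pos (by positivity)
  have hκ1 : κ ≤ 1 := min_le_left _ _
  have hκ2 : κ ≤ σ / 4 := min_le_right _ _
  have hc := Real.cos_le_one_sub_mul_cos_sq hφ
  have hc1 := Real.neg_one_le_cos φ
  have hc2 := Real.cos_le_one φ
  set y := 2 * (1 - cos φ) / (2 + s) with hy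
  have e : (s + 2 * cos φ) / (2 + s) = 1 - y := by rw [hy]; field_simp; ring
  have hy0 : 0 ≤ y := by rw [hy]; apply div_nonneg <;> linarith
  have hy1 : y * (1 + κ) ≤ 2 := by
    rw [hy, div_mul_eq_mul_div, div_le_iff₀ (by linarith)]
    nlinarith
  have hy2 : 4 / π ^ 2 / (2 + 2 * σ) * φ ^ 2 ≤ y := by
    have h1 : 4 / π ^ 2 * φ ^ 2 ≤ 2 * (1 - cos φ) := by
      have : 4 / π ^ 2 * φ ^ 2 = 2 * (2 / π ^ 2 * φ ^ 2) := by ring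
      linarith
    rw [hy, div_mul_eq_mul_div]
    have : 0 ≤ 4 / π ^ 2 * φ ^ 2 := by positivity
    gcongr
  have h1 : |1 - y| ≤ rexp (-(κ * y)) := by
    refine le_trans ?_ (Real.add_one_le_exp _)
    rw [abs_le]
    constructor <;> nlinarith
  rw [abs_pow, e]
  calc |1 - y| ^ N ≤ rexp (-(κ * y)) ^ N := by gcongr
    _ = rexp (-(N * (κ * y))) := by rw [← Real.exp_nat_mul]; congr 1; ring
    _ ≤ _ := by
      apply Real.exp_le_exp.2
      have : (N : ℝ) * (κ * (4 / π ^ 2 / (2 + 2 * σ) * φ ^ 2)) ≤ N * (κ * y) := by gcongr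
      have e : 4 / π ^ 2 * κ / (2 + 2 * σ) * (N * φ ^ 2) =
        (N : ℝ) * (κ * (4 / π ^ 2 / (2 + 2 * σ) * φ ^ 2)) := by ring
      linarith

theorem eventually_abs_cos_pow_le {σ Δ : ℝ} (hσ : 0 < σ) (hΔ : 0 < Δ) {s : ℕ → ℝ}
    (hs : Tendsto s atTop (𝓝 σ)) {N : ℕ → ℕ} (hN : Tendsto (fun L => (N L : ℝ) / L) atTop (𝓝 Δ)) :
    ∃ κ > 0, ∀ᶠ L : ℕ in atTop, ∀ v, |v / √(L : ℝ)| ≤ π →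
      |((s L + 2 * cos (v / √(L : ℝ))) / (2 + s L)) ^ N L| ≤ rexp (-κ * v ^ 2) := by
  set K := 4 / π ^ 2 * min 1 (σ / 4) / (2 + 2 * σ) with hK
  have hK0 : 0 < K := by
    have : 0 < min 1 (σ / 4) := lt_min one_pos (by positivity)
    positivity
  refine ⟨K * (Δ / 2), by positivity, ?_⟩
  filter_upwards [hs.eventually (le_mem_nhds (show σ / 2 < σ by linarith)),
    hs.eventually (ge_mem_nhds (show σ < 2 * σ by linarith)),
    hN.eventually (le_mem_nhds (show Δ / 2 < Δ by linarith)), eventually_gt_atTop 0]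
    with L h1 h2 h3 h4 v hv
  refine (abs_cos_pow_le hσ h1 h2 hv (N L)).trans ?_
  apply Real.exp_le_exp.2
  rw [div_pow, Real.sq_sqrt (Nat.cast_nonneg L), ← hK]
  have e : (N L : ℝ) * (v ^ 2 / L) = (N L / L) * v ^ 2 := by ring
  rw [e]
  have : Δ / 2 * v ^ 2 ≤ (N L / L) * v ^ 2 := by gcongr
  nlinarith

/-! ### Limit of the numerator -/

/-- The limit of the rescaled densities of block functions. -/
noncomputable def chainLimit (σ : ℝ) (T Δ : ℕ → ℝ) (n : ℕ) (u : Fin (n + 1) → ℝ) : ℝ :=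
  (∏ i : Fin (n + 1), 1 / (π * √(u i)) * rexp (-(1 / (2 + σ)) * (Δ i * u i))) *
    (√(u 0) / (T 0 ^ 2 + u 0) * (√(u (Fin.last n)) / (T (n + 1) ^ 2 + u (Fin.last n))) *
      ∏ i : Fin n, π * √(u i.castSucc) * bianeKernel (T (i + 1)) (u i.castSucc) (u i.succ))

/-- Dominated convergence. The `n + 1` densities are of order 1/√L each and the `n + 2` generating
functions of order √L each, so one factor √L survives. The same dominating function makes the limit
integrable. -/
theorem tendsto_integral_chainDensity {σ : ℝ} (hσ : 0 < σ) (n : ℕ) {r s : ℕ → ℕ → ℝ}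
    {N : ℕ → ℕ → ℕ} {T Δ : ℕ → ℝ}
    (hr : ∀ k, Tendsto (fun L : ℕ => √(L : ℝ) * (1 - r L k)) atTop (𝓝 (T k)))
    (hT : ∀ k, 0 < T k) (hr0 : ∀ᶠ L in atTop, ∀ k, 0 ≤ r L k ∧ r L k < 1)
    (hs : ∀ k, Tendsto (fun L => s L k) atTop (𝓝 σ))
    (hN : ∀ k < n + 1, Tendsto (fun L => (N L k : ℝ) / L) atTop (𝓝 (Δ k)))
    (hΔ : ∀ k < n + 1, 0 < Δ k) :
    Integrable (chainLimit σ T Δ n) (Measure.pi fun _ => volume.restrict (Ioi 0)) ∧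
    Tendsto (fun L : ℕ => (√(L : ℝ) * ∏ i : Fin (n + 1), (2 + s L i) ^ N L i)⁻¹ *
      ∫ u, chainDensity (angleDensity L) (angle L) (r L) (s L) (N L) n u *
        sinGen (r L (n + 1)) (angle L (u (Fin.last n)))
        ∂(Measure.pi fun _ => volume.restrict (Ioi 0))) atTop
      (𝓝 (∫ u, chainLimit σ T Δ n u ∂(Measure.pi fun _ => volume.restrict (Ioi 0)))) := by
  set μ : Measure (Fin (n + 1) → ℝ) := Measure.pi fun _ => volume.restrict (Ioi 0) with hμ
  have hae : ∀ᵐ u ∂μ, ∀ i, 0 < u i := by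
    rw [hμ, ← Measure.restrict_pi_pi]
    refine (ae_restrict_mem (MeasurableSet.univ_pi fun _ => measurableSet_Ioi)).mono fun u hu i => ?_
    exact hu i (mem_univ i)
  choose! κ hκ0 hκ using fun k hk => eventually_abs_cos_pow_le hσ (hΔ k hk) (hs k) (hN k hk)
  set F : ℕ → (Fin (n + 1) → ℝ) → ℝ := fun L u =>
    (∏ i : Fin (n + 1), (√(L : ℝ) * angleDensity L (u i)) *
      ((s L i + 2 * cos (√(u i) / √(L : ℝ))) / (2 + s L i)) ^ N L i) *
    (sinGen (r L 0) (angle L (u 0)) / √(L : ℝ) *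
      (sinGen (r L (n + 1)) (angle L (u (Fin.last n))) / √(L : ℝ)) *
      ∏ i : Fin n, sinKer (r L (i + 1)) (angle L (u i.castSucc)) (angle L (u i.succ)) / √(L : ℝ))
    with hF
  -- The constants 2 / T come from √L (1 - r) ≥ T / 2, valid for large L.
  set bound : (Fin (n + 1) → ℝ) → ℝ := fun u =>
    (∏ i : Fin (n + 1), rexp (-κ i * u i) / √(u i)) *
      (2 / T 0 * (2 / T (n + 1)) * ∏ i : Fin n, 2 / T (i + 1)) with hbound
  have hbi : Integrable bound μ := by
    refine Integrable.mul_const ?_ _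
    exact Integrable.fintype_prod (f := fun (i : Fin (n + 1)) u => rexp (-κ i * u) / √u)
      fun i => integrableOn_exp_div_sqrt (hκ0 i i.2)
  have hmeas : ∀ L, Measurable (F L) := fun L => by
    have h1 := measurable_angle L
    have h2 := measurable_angleDensity L
    rw [hF]
    fun_prop
  have hspos : ∀ k, ∀ᶠ L in atTop, 0 < 2 + s L k := fun k =>
    ((hs k).const_add 2).eventually (lt_mem_nhds (by positivity))
  have heq : ∀ᶠ L : ℕ in atTop, ∀ u, (√(L : ℝ) * ∏ i : Fin (n + 1), (2 + s L i) ^ N L i)⁻¹ *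
      (chainDensity (angleDensity L) (angle L) (r L) (s L) (N L) n u *
        sinGen (r L (n + 1)) (angle L (u (Fin.last n)))) = F L u := by
    filter_upwards [eventually_gt_atTop 0, (Finset.range (n + 1)).eventually_all.2
      fun k _ => hspos k] with L hL hp u
    have hs : √(L : ℝ) ≠ 0 := by positivity
    have hp : ∏ i : Fin (n + 1), (2 + s L i) ^ N L i ≠ 0 :=
      Finset.prod_ne_zero_iff.2 fun i _ => pow_ne_zero _ (hp i (by simp; omega)).ne'
    simp only [hF, chainDensity, div_pow, Finset.prod_mul_distrib, Finset.prod_div_distrib,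
      Finset.prod_const, Finset.card_univ, Fintype.card_fin]
    change _ * (_ * (_ * _) * _) = _
    simp only [angle]
    field_simp
    ring
  have hr2 : ∀ k, ∀ᶠ L : ℕ in atTop, 1 / (1 - r L k) / √(L : ℝ) ≤ 2 / T k := fun k => by
    filter_upwards [(hr k).eventually (le_mem_nhds (show T k / 2 < T k by linarith [hT k])),
      eventually_gt_atTop 0] with L h hL
    rw [div_div, mul_comm (1 - r L k), ← one_div_div (T k) 2]
    exact one_div_le_one_div_of_le (by have := hT k; positivity) h
  have hle : ∀ᶠ L in atTop, ∀ᵐ u ∂μ, ‖F L u‖ ≤ bound u := by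
    filter_upwards [hr0, (Finset.range (n + 2)).eventually_all.2 fun k _ => hr2 k,
      (Finset.range (n + 1)).eventually_all.2 fun k hk => hκ k (by simpa using hk)] with L h1 h2 h3
    filter_upwards [hae] with u hu
    have hgen : ∀ k < n + 2, ∀ α, |sinGen (r L k) α / √(L : ℝ)| ≤ 2 / T k := fun k hk α => by
      rw [abs_div, abs_of_nonneg (sqrt_nonneg _)]
      exact (div_le_div_of_nonneg_right (abs_sinGen_le (h1 k).1 (h1 k).2 α) (sqrt_nonneg _)).trans
        (h2 k (by simpa using hk))
    have hker : ∀ k < n + 2, ∀ α β, |sinKer (r L k) α β / √(L : ℝ)| ≤ 2 / T k := fun k hk α β => by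
      rw [abs_div, abs_of_nonneg (sqrt_nonneg _)]
      exact (div_le_div_of_nonneg_right (abs_sinKer_le (h1 k).1 (h1 k).2 α β) (sqrt_nonneg _)).trans
        (h2 k (by simpa using hk))
    have hT' : ∀ k, 0 ≤ 2 / T k := fun k => by have := hT k; positivity
    simp only [hF, hbound, Real.norm_eq_abs, abs_mul, Finset.abs_prod]
    refine mul_le_mul (Finset.prod_le_prod (fun _ _ => by positivity) fun i _ => ?_)
      (mul_le_mul (mul_le_mul (hgen _ (by omega) _) (hgen _ (by omega) _) (abs_nonneg _) (hT' _))
        (Finset.prod_le_prod (fun _ _ => abs_nonneg _) fun i _ => hker _ (by omega) _ _)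
        (by positivity) (mul_nonneg (hT' _) (hT' _))) (by positivity)
      (Finset.prod_nonneg fun i _ => by positivity)
    -- The Gaussian bound holds only for angles up to π; beyond, the density vanishes.
    by_cases hi : angle L (u i) < π
    · have h4 := h3 i (by simp; omega) (√(u i)) 
        ((abs_of_nonneg (angle_nonneg L (u i))).trans_le hi.le)
      rw [Real.sq_sqrt (hu i).le] at h4
      have h5 := sqrt_mul_angleDensity_le L (u i)
      rw [← abs_mul, abs_of_nonneg (mul_nonneg (sqrt_nonneg _) (angleDensity_nonneg _ _))]
      calc _ ≤ 1 / √(u i) * rexp (-κ i * u i) := by gcongr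
        _ = _ := by ring
    · have : angleDensity L (u i) = 0 := if_neg hi
      rw [this, abs_zero, mul_zero, zero_mul]
      positivity
  have hlim : ∀ᵐ u ∂μ, Tendsto (fun L => F L u) atTop (𝓝 (chainLimit σ T Δ n u)) := by
    filter_upwards [hae] with u hu
    refine Tendsto.mul (tendsto_finsetProd _ fun i _ => ?_)
      (((tendsto_sinGen_div_sqrt (hT 0) (hr 0) (hu 0).le).mul
        (tendsto_sinGen_div_sqrt (hT _) (hr _) (hu _).le)).mul (tendsto_finsetProd _ fun i _ =>
          tendsto_sinKer_div_sqrt (hT _) (hr _) (hu _).le (hu _).le))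
    have h := tendsto_cos_pow hσ (hs i) (hN i i.2) (√(u i))
    rw [Real.sq_sqrt (hu i).le] at h
    exact (tendsto_sqrt_mul_angleDensity (hu i)).mul h
  constructor
  · refine hbi.mono' (aestronglyMeasurable_of_tendsto_ae atTop
      (fun L => (hmeas L).aestronglyMeasurable) hlim) ?_
    obtain ⟨L₀, hL₀⟩ := eventually_atTop.1 hle
    have hall : ∀ᵐ u ∂μ, ∀ L ≥ L₀, ‖F L u‖ ≤ bound u := by
      rw [ae_all_iff]; intro L
      by_cases h : L ≥ L₀
      · filter_upwards [hL₀ L h] with u hu _ using hu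
      · exact ae_of_all _ fun u h' => absurd h' h
    filter_upwards [hall, hlim] with u h1 h2
    exact le_of_tendsto h2.norm (eventually_atTop.2 ⟨L₀, h1⟩)
  · refine (tendsto_integral_filter_of_dominated_convergence bound
      (.of_forall fun L => (hmeas L).aestronglyMeasurable) hle hbi hlim).congr' ?_
    filter_upwards [heq] with L h
    rw [← integral_const_mul]
    simp_rw [h]

/-! ### The unconstrained walk: reflection, decay, local limit -/

/-- The coefficient of `X ^ k` in `(X + σ + X⁻¹) ^ L`. -/
noncomputable def walkCoeff (σ : ℝ) : ℕ → ℤ → ℝ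
  | 0 => fun k => if k = 0 then 1 else 0
  | L + 1 => fun k => walkCoeff σ L (k - 1) + σ * walkCoeff σ L k + walkCoeff σ L (k + 1)

theorem walkCoeff_neg (σ : ℝ) (L : ℕ) (k : ℤ) : walkCoeff σ L (-k) = walkCoeff σ L k := by
  induction L generalizing k with
  | zero => simp [walkCoeff]
  | succ L ih =>
    simp only [walkCoeff]
    rw [show -k - 1 = -(k + 1) by ring, show -k + 1 = -(k - 1) by ring, ih, ih, ih]; ring

/-- Reflection principle: paths that touch -1 are removed by reflecting m ↦ -m - 2. By symmetry of
the coefficients the difference vanishes at altitude -1, which supplies the boundary case m = 0. No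
condition on ρ is needed, since only finitely many terms are nonzero. -/
theorem hasSum_iterate_motzkinStep (σ ρ : ℝ) (L m : ℕ) :
    HasSum (fun m' : ℕ => ρ ^ m' * (walkCoeff σ L (m - m') - walkCoeff σ L (m + m' + 2)))
      ((motzkinStep σ)^[L] (fun m => ρ ^ m) m) := by
  induction L generalizing m with
  | zero =>
    refine (hasSum_ite_eq m (ρ ^ m)).of_eq (fun m' => ?_) rfl
    have : (m : ℤ) + m' + 2 ≠ 0 := by omega
    simp only [walkCoeff, this, if_false, sub_eq_zero, Nat.cast_inj, eq_comm (a := m)]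
    split_ifs with h <;> simp [h]
  | succ L ih =>
    rw [Function.iterate_succ_apply', motzkinStep]
    have h0 := ((ih (m + 1)).add ((ih m).mul_left σ))
    rcases m with _ | m
    · rw [if_pos rfl, add_zero]
      refine h0.of_eq (fun m' => ?_) rfl
      have e : walkCoeff σ L (-1 - m') = walkCoeff σ L (m' + 1) := by
        rw [← walkCoeff_neg]; congr 1; ring
      simp only [walkCoeff]
      push_cast
      rw [show (0 : ℤ) - m' - 1 = -1 - m' by ring, e,
        show (0 : ℤ) + m' + 2 - 1 = m' + 1 by ring,
        show (0 : ℤ) - m' + 1 = 0 + 1 - m' by ring,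
        show (0 : ℤ) + m' + 2 + 1 = 0 + 1 + m' + 2 by ring]
      ring_nf
    · rw [if_neg (by omega), Nat.add_sub_cancel]
      refine (h0.add (ih m)).of_eq (fun m' => ?_) rfl
      simp only [walkCoeff]
      push_cast
      rw [show (m : ℤ) + 1 - m' - 1 = m - m' by ring,
        show (m : ℤ) + 1 + m' + 2 - 1 = m + m' + 2 by ring,
        show (m : ℤ) + 1 - m' + 1 = m + 1 + 1 - m' by ring,
        show (m : ℤ) + 1 + m' + 2 + 1 = m + 1 + 1 + m' + 2 by ring]
      ring

theorem integral_cexp_int_mul (k : ℤ) :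
    ∫ y in (-π)..π, Complex.exp (k * (y * Complex.I)) = if k = 0 then 2 * π else 0 := by
  split_ifs with h
  · simp [h]; ring
  · have hk : (k : ℂ) * Complex.I ≠ 0 := mul_ne_zero (by exact_mod_cast h) Complex.I_ne_zero
    have e : ∀ y : ℝ, Complex.exp (k * (y * Complex.I)) = Complex.exp (k * Complex.I * y) :=
      fun y => by congr 1; ring
    simp_rw [e]
    rw [integral_exp_mul_complex hk]
    have : Complex.exp (k * Complex.I * ((π : ℝ) : ℂ)) =
        Complex.exp (k * Complex.I * ((-π : ℝ) : ℂ)) := by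
      rw [Complex.exp_eq_exp_iff_exists_int]
      exact ⟨k, by push_cast; ring⟩
    rw [this]; simp

/-- Cauchy's formula on the circle of radius e^z, with X = e^{z + iy}, checked through the
recursion. The free parameter `z` is what later produces exponential decay in `k`. -/
theorem walkCoeff_eq_integral (σ z : ℝ) (L : ℕ) (k : ℤ) :
    (walkCoeff σ L k : ℂ) = (1 / (2 * π)) * ∫ y in (-π)..π,
      (σ + 2 * Complex.cosh (z + y * Complex.I)) ^ L *
        Complex.exp (-k * (z + y * Complex.I)) := by
  induction L generalizing k with
  | zero =>
    have e : ∀ y : ℝ, ((σ : ℂ) + 2 * Complex.cosh (z + y * Complex.I)) ^ 0 *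
        Complex.exp (-k * (z + y * Complex.I)) =
        Complex.exp (-k * z) * Complex.exp (((-k : ℤ) : ℂ) * (y * Complex.I)) := fun y => by
      rw [pow_zero, one_mul, ← Complex.exp_add]; congr 1; push_cast; ring
    simp_rw [e]
    rw [intervalIntegral.integral_const_mul, integral_cexp_int_mul, walkCoeff]
    have : (π : ℂ) ≠ 0 := by exact_mod_cast pi_ne_zero
    by_cases h : k = 0
    · simp [h]; field_simp
    · simp [h]
  | succ L ih =>
    have e : ∀ y : ℝ, ((σ : ℂ) + 2 * Complex.cosh (z + y * Complex.I)) ^ (L + 1) *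
        Complex.exp (-k * (z + y * Complex.I)) =
        (σ + 2 * Complex.cosh (z + y * Complex.I)) ^ L *
          Complex.exp (-((k - 1 : ℤ) : ℂ) * (z + y * Complex.I)) +
        σ * ((σ + 2 * Complex.cosh (z + y * Complex.I)) ^ L *
          Complex.exp (-k * (z + y * Complex.I))) +
        (σ + 2 * Complex.cosh (z + y * Complex.I)) ^ L *
          Complex.exp (-((k + 1 : ℤ) : ℂ) * (z + y * Complex.I)) := fun y => by
      set w : ℂ := z + y * Complex.I
      have h1 : Complex.exp (-((k - 1 : ℤ) : ℂ) * w) = Complex.exp w * Complex.exp (-k * w) := by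
        rw [← Complex.exp_add]; congr 1; push_cast; ring
      have h2 : Complex.exp (-((k + 1 : ℤ) : ℂ) * w) =
          Complex.exp (-w) * Complex.exp (-k * w) := by
        rw [← Complex.exp_add]; congr 1; push_cast; ring
      rw [h1, h2, pow_succ, Complex.cosh]; ring
    have hi : ∀ k : ℤ, IntervalIntegrable (fun y : ℝ =>
        ((σ : ℂ) + 2 * Complex.cosh (z + y * Complex.I)) ^ L *
          Complex.exp (-k * (z + y * Complex.I))) volume (-π) π := fun k =>
      Continuous.intervalIntegrable (by fun_prop) _ _
    simp_rw [e]
    rw [intervalIntegral.integral_add ((hi _).add ((hi _).const_mul _)) (hi _),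
      intervalIntegral.integral_add (hi _) ((hi _).const_mul _),
      intervalIntegral.integral_const_mul, walkCoeff]
    push_cast
    rw [ih, ih, ih]
    push_cast
    ring

theorem norm_add_two_cosh_sq (σ z y : ℝ) :
    ‖(σ : ℂ) + 2 * Complex.cosh (z + y * Complex.I)‖ ^ 2 =
      (σ + 2 * Real.cosh z * cos y) ^ 2 + (2 * Real.sinh z * sin y) ^ 2 := by
  have : (σ : ℂ) + 2 * Complex.cosh (z + y * Complex.I) =
      ((σ + 2 * Real.cosh z * cos y : ℝ) : ℂ) + ((2 * Real.sinh z * sin y : ℝ) : ℂ) * Complex.I := by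
    rw [Complex.cosh_add, Complex.cosh_mul_I, Complex.sinh_mul_I]
    push_cast; ring
  rw [this, Complex.sq_norm, Complex.normSq_add_mul_I]

/-- A Gaussian bound for the generating polynomial of the walk in a vertical strip. -/
theorem exists_norm_add_two_cosh_le {σ : ℝ} (hσ : 0 < σ) :
    ∃ κ > 0, ∃ M > 0, ∀ z y : ℝ, |y| ≤ π →
      ‖(σ : ℂ) + 2 * Complex.cosh (z + y * Complex.I)‖ ≤
        (2 + σ) * rexp (M * z ^ 2 - κ * y ^ 2) := by
  set κ := 4 / π ^ 2 * min 1 (σ / 4) / (2 + 2 * σ) with hκ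
  have hκ0 : 0 < κ := by
    have : 0 < min 1 (σ / 4) := lt_min one_pos (by positivity)
    positivity
  -- Chosen so that E² M ≥ 2 for |y| ≤ π, where E = exp(-κy²): the growth due to z is then absorbed
  -- even where the Gaussian factor is smallest. The estimate is proved for squares, hence M / 2
  -- below.
  set M := 2 * rexp (2 * κ * π ^ 2) with hM
  have hM1 : 1 ≤ M := by
    have : 1 ≤ rexp (2 * κ * π ^ 2) := Real.one_le_exp (by positivity)
    linarith
  refine ⟨κ, hκ0, M / 2, by positivity, fun z y hy => ?_⟩
  have hc := abs_cos_pow_le hσ (by linarith : σ / 2 ≤ σ) (by linarith : σ ≤ 2 * σ) hy 1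
  rw [pow_one, ← hκ, Nat.cast_one, one_mul, abs_div, abs_of_pos (by linarith : 0 < 2 + σ),
    div_le_iff₀ (by linarith)] at hc
  set E := rexp (-κ * y ^ 2) with hE
  have hE0 : 0 < E := Real.exp_pos _
  have hE2 : 2 ≤ E ^ 2 * M := by
    rw [hE, hM, ← Real.exp_nat_mul, mul_left_comm, ← Real.exp_add]
    have h1 : y ^ 2 ≤ π ^ 2 := sq_le_sq' (abs_le.1 hy).1 (abs_le.1 hy).2
    have : 1 ≤ rexp (((2 : ℕ) : ℝ) * (-κ * y ^ 2) + 2 * κ * π ^ 2) := Real.one_le_exp (by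
      push_cast; nlinarith)
    linarith
  have hch1 := Real.one_le_cosh z
  have hch2 : Real.cosh z ^ 2 ≤ rexp (z ^ 2) := by
    calc Real.cosh z ^ 2 ≤ rexp (z ^ 2 / 2) ^ 2 := by
          gcongr; exact Real.cosh_le_exp_half_sq z
      _ = _ := by rw [← Real.exp_nat_mul]; congr 1; push_cast; ring
  have hsh := Real.cosh_sq z
  have hsc := Real.sin_sq_add_cos_sq y
  -- Bernoulli's inequality for (1 + x)^M with x = exp(z²) - 1.
  have hbern : 1 + M * (rexp (z ^ 2) - 1) ≤ rexp (M * z ^ 2) := by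
    have h := one_add_mul_self_le_rpow_one_add (s := rexp (z ^ 2) - 1)
      (by linarith [Real.exp_pos (z ^ 2)]) hM1
    rwa [add_sub_cancel, ← Real.exp_mul, mul_comm (z ^ 2)] at h
  refine (sq_le_sq₀ (norm_nonneg _) (by positivity)).1 ?_
  rw [norm_add_two_cosh_sq]
  have hc1 := Real.neg_one_le_cos y
  have hc2 := Real.cos_le_one y
  set c := Real.cosh z
  set A := σ + 2 * cos y with hA
  have hA1 : A ^ 2 ≤ (2 + σ) ^ 2 * E ^ 2 := by
    rw [← sq_abs, ← mul_pow, mul_comm]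
    exact pow_le_pow_left₀ (abs_nonneg _) hc 2
  have hA2 : A * cos y ≤ 2 + σ := by
    have h1 : σ * cos y ≤ σ := mul_le_of_le_one_right hσ.le hc2
    have h2 := sq_nonneg (sin y)
    rw [hA, add_mul, mul_assoc, ← sq]
    linarith
  have hcos : cos y ^ 2 ≤ 1 := by linarith [sq_nonneg (sin y)]
  have hsin : sin y ^ 2 ≤ 1 := by linarith [sq_nonneg (cos y)]
  have e : (σ + 2 * c * cos y) ^ 2 + (2 * Real.sinh z * sin y) ^ 2 =
      A ^ 2 + 4 * (A * cos y) * (c - 1) + 4 * cos y ^ 2 * (c - 1) ^ 2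
        + 4 * (c ^ 2 - 1) * sin y ^ 2 := by
    rw [mul_pow, mul_pow, (by linarith : Real.sinh z ^ 2 = c ^ 2 - 1), hA]; ring
  have hd : 0 ≤ c - 1 := by linarith
  have hd2 : 0 ≤ c ^ 2 - 1 := sub_nonneg.2 (one_le_pow₀ hch1)
  have h1 : (σ + 2 * c * cos y) ^ 2 + (2 * Real.sinh z * sin y) ^ 2 ≤
      (2 + σ) ^ 2 * E ^ 2 + 4 * (2 + σ) * (c - 1) + 4 * 1 * (c - 1) ^ 2 + 4 * (c ^ 2 - 1) * 1 := by
    rw [e]; gcongr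
  have h2 : 4 * (2 + σ) * (c - 1) + 4 * 1 * (c - 1) ^ 2 + 4 * (c ^ 2 - 1) * 1 ≤
      (2 + σ) ^ 2 * (2 * (c ^ 2 - 1)) := by
    have e : (2 + σ) ^ 2 * (2 * (c ^ 2 - 1)) = (2 + σ) ^ 2 * 2 * (c - 1) +
      (2 + σ) ^ 2 * (c - 1) ^ 2 + (2 + σ) ^ 2 * (c ^ 2 - 1) := by ring
    have h4e : (2 + σ) ^ 2 = 4 + 4 * σ + σ ^ 2 := by ring
    have h4s := sq_nonneg σ
    have h4 : 4 ≤ (2 + σ) ^ 2 := by linarith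
    have h4' : 4 * (2 + σ) ≤ (2 + σ) ^ 2 * 2 := by linarith
    rw [e]
    have := mul_le_mul_of_nonneg_right h4' hd
    have := mul_le_mul_of_nonneg_right h4 (sq_nonneg (c - 1))
    have := mul_le_mul_of_nonneg_right h4 hd2
    linarith
  have h3 : E ^ 2 + 2 * (c ^ 2 - 1) ≤ E ^ 2 * rexp (M * z ^ 2) := by
    have h5 : 2 * (c ^ 2 - 1) ≤ E ^ 2 * M * (rexp (z ^ 2) - 1) :=
      mul_le_mul hE2 (by linarith) hd2 (by positivity)
    have := mul_le_mul_of_nonneg_left hbern (sq_nonneg E)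
    linarith
  have h6 : ((2 + σ) * rexp (M / 2 * z ^ 2 - κ * y ^ 2)) ^ 2 =
      (2 + σ) ^ 2 * (E ^ 2 * rexp (M * z ^ 2)) := by
    rw [mul_pow, hE, ← Real.exp_nat_mul, ← Real.exp_nat_mul, ← Real.exp_add]
    congr 2; push_cast; ring
  rw [h6]
  have := mul_le_mul_of_nonneg_left h3 (sq_nonneg (2 + σ))
  linarith

/-- The coefficients decay exponentially on the scale `√L`, at any rate. -/
theorem exists_abs_walkCoeff_le {σ : ℝ} (hσ : 0 < σ) (K : ℝ) :
    ∃ C > 0, ∀ L : ℕ, 0 < L → ∀ k : ℤ,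
      √(L : ℝ) * |walkCoeff σ L k| / (2 + σ) ^ L ≤ C * rexp (-(K * |(k : ℝ)| / √(L : ℝ))) := by
  obtain ⟨κ, hκ, M, hM, hb⟩ := exists_norm_add_two_cosh_le hσ
  refine ⟨rexp (M * K ^ 2) * √(π / κ), by positivity, fun L hL k => ?_⟩
  have hs : 0 < √(L : ℝ) := by positivity
  have hL' : (L : ℝ) = √(L : ℝ) ^ 2 := (Real.sq_sqrt (Nat.cast_nonneg L)).symm
  -- The contour is moved to z = ±K/√L, with the sign of k. The cost exp(M L z²) = exp(M K²) is
  -- constant, and the Gaussian integral in y supplies the factor 1/√L.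
  have key : ∀ z : ℝ, z ^ 2 = K ^ 2 / L → |walkCoeff σ L k| ≤
      (2 + σ) ^ L * (rexp (M * K ^ 2) * rexp (-(k * z)) * (√(π / κ) / √(L : ℝ))) := by
    intro z hz
    have h1 : |walkCoeff σ L k| = ‖(walkCoeff σ L k : ℂ)‖ := by
      rw [Complex.norm_real, Real.norm_eq_abs]
    rw [h1, walkCoeff_eq_integral σ z L k, norm_mul]
    have hp : ‖(1 / (2 * π) : ℂ)‖ ≤ 1 := by
      have : (1 / (2 * π) : ℂ) = ((1 / (2 * π) : ℝ) : ℂ) := by push_cast; rfl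
      rw [this, Complex.norm_real, Real.norm_of_nonneg (by positivity), div_le_one (by positivity)]
      linarith [Real.two_le_pi]
    refine (mul_le_of_le_one_left (norm_nonneg _) hp).trans ?_
    have hgi : Integrable (fun y : ℝ => (2 + σ) ^ L * (rexp (M * K ^ 2) * rexp (-(k * z))) *
        rexp (-(L * κ) * y ^ 2)) :=
      (integrable_exp_neg_mul_sq (by positivity)).const_mul _
    have h2 : ‖∫ y in (-π)..π, ((σ : ℂ) + 2 * Complex.cosh (z + y * Complex.I)) ^ L *
        Complex.exp (-k * (z + y * Complex.I))‖ ≤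
        ∫ y in (-π)..π, (2 + σ) ^ L * (rexp (M * K ^ 2) * rexp (-(k * z))) *
          rexp (-(L * κ) * y ^ 2) := by
      refine intervalIntegral.norm_integral_le_of_norm_le (by linarith [pi_pos])
        (ae_of_all _ fun y hy => ?_) hgi.intervalIntegrable
      have hy' : |y| ≤ π := abs_le.2 ⟨hy.1.le, hy.2⟩
      rw [norm_mul, norm_pow, Complex.norm_exp]
      have e1 : (-(k : ℂ) * (z + y * Complex.I)).re = -(k * z) := by simp
      rw [e1]
      calc _ ≤ ((2 + σ) * rexp (M * z ^ 2 - κ * y ^ 2)) ^ L * rexp (-(k * z)) := by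
            gcongr; exact hb z y hy'
        _ = _ := by
          rw [mul_pow, ← Real.exp_nat_mul, mul_assoc, mul_assoc, ← Real.exp_add, mul_assoc,
            ← Real.exp_add, ← Real.exp_add, hz]
          congr 2
          have : (L : ℝ) ≠ 0 := by positivity
          field_simp
          ring
    refine h2.trans ?_
    rw [intervalIntegral.integral_of_le (by linarith [pi_pos])]
    refine (setIntegral_le_integral hgi (ae_of_all _ fun y => by positivity)).trans_eq ?_
    rw [integral_const_mul, integral_gaussian]
    have : √(π / (L * κ)) = √(π / κ) / √(L : ℝ) := by
      rw [← Real.sqrt_div (by positivity)]; congr 1; field_simp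
    rw [this]; ring
  have hz : (K / √(L : ℝ)) ^ 2 = K ^ 2 / L := by rw [div_pow, ← hL']
  rw [div_le_iff₀ (by positivity)]
  have fin : ∀ z : ℝ, z ^ 2 = K ^ 2 / L → k * z = K * |(k : ℝ)| / √(L : ℝ) →
      √(L : ℝ) * |walkCoeff σ L k| ≤
        rexp (M * K ^ 2) * √(π / κ) * rexp (-(K * |(k : ℝ)| / √(L : ℝ))) * (2 + σ) ^ L := by
    intro z h1 h2
    have h := mul_le_mul_of_nonneg_left (key z h1) hs.le
    rw [h2] at h
    refine h.trans_eq ?_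
    field_simp
  rcases le_total 0 (k : ℝ) with hk | hk
  · exact fin (K / √(L : ℝ)) hz (by rw [abs_of_nonneg hk]; ring)
  · exact fin (-(K / √(L : ℝ))) (by rw [neg_sq, hz]) (by rw [abs_of_nonpos hk]; ring)

/-- The local central limit theorem for the coefficients. -/
theorem tendsto_walkCoeff {σ : ℝ} (hσ : 0 < σ) {k : ℕ → ℤ} {y : ℝ}
    (hk : Tendsto (fun L => (k L : ℝ) / √(L : ℝ)) atTop (𝓝 y)) :
    Tendsto (fun L : ℕ => √(L : ℝ) * walkCoeff σ L (k L) / (2 + σ) ^ L) atTop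
      (𝓝 (√(2 + σ) / (2 * √π) * rexp (-(y ^ 2 * (2 + σ) / 4)))) := by
  have hN : Tendsto (fun L : ℕ => (L : ℝ) / L) atTop (𝓝 1) := by
    refine tendsto_const_nhds.congr' ?_
    filter_upwards [eventually_gt_atTop 0] with L hL
    have : (L : ℝ) ≠ 0 := by positivity
    rw [div_self this]
  obtain ⟨κ, hκ, hb⟩ := eventually_abs_cos_pow_le hσ one_pos
    (s := fun _ => σ) tendsto_const_nhds (N := fun L => L) hN
  -- Cauchy's integrand on the unit circle (z = 0) after y = v/√L, extended by zero to the whole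
  -- line; its limit is a Gaussian times a character.
  set F : ℕ → ℝ → ℂ := fun L => (Ioc (-(√(L : ℝ) * π)) (√(L : ℝ) * π)).indicator fun v =>
    ((((σ + 2 * cos (v / √(L : ℝ))) / (2 + σ)) ^ L : ℝ) : ℂ) *
      Complex.exp (Complex.I * ((-((k L : ℝ) / √(L : ℝ)) : ℝ) : ℂ) * v) with hF
  have hint : Tendsto (fun L => ∫ v, F L v) atTop (𝓝 (∫ v : ℝ,
      Complex.exp (Complex.I * ((-y : ℝ) : ℂ) * v) *
        Complex.exp (-((1 / (2 + σ) : ℝ) : ℂ) * v ^ 2))) := by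
    refine tendsto_integral_filter_of_dominated_convergence (fun v => rexp (-κ * v ^ 2))
      (.of_forall fun L => ?_) ?_ (integrable_exp_neg_mul_sq hκ) (ae_of_all _ fun v => ?_)
    · exact (Continuous.aestronglyMeasurable (by fun_prop)).indicator measurableSet_Ioc
    · filter_upwards [hb, eventually_gt_atTop 0] with L h hL
      have hs : 0 < √(L : ℝ) := by positivity
      refine ae_of_all _ fun v => ?_
      simp only [hF]
      by_cases hv : v ∈ Ioc (-(√(L : ℝ) * π)) (√(L : ℝ) * π)
      · rw [indicator_of_mem hv, norm_mul, Complex.norm_real, Complex.norm_exp]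
        have e : (Complex.I * ((-((k L : ℝ) / √(L : ℝ)) : ℝ) : ℂ) * v).re = 0 := by
          rw [Complex.re_mul_ofReal, Complex.re_mul_ofReal]; simp
        rw [e, Real.exp_zero, mul_one]
        refine h v ?_
        rw [abs_div, abs_of_pos hs, div_le_iff₀ hs, mul_comm]
        exact abs_le.2 ⟨hv.1.le, hv.2⟩
      · rw [indicator_of_notMem hv, norm_zero]; positivity
    · have h1 := tendsto_cos_pow hσ (s := fun _ => σ) tendsto_const_nhds (N := fun L => L) hN v
      have h2 : Tendsto (fun L : ℕ => (((((σ + 2 * cos (v / √(L : ℝ))) / (2 + σ)) ^ L : ℝ) : ℂ) *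
          Complex.exp (Complex.I * ((-((k L : ℝ) / √(L : ℝ)) : ℝ) : ℂ) * v))) atTop
          (𝓝 (((rexp (-(1 / (2 + σ)) * (1 * v ^ 2)) : ℝ) : ℂ) *
            Complex.exp (Complex.I * ((-y : ℝ) : ℂ) * v))) := by
        refine ((Complex.continuous_ofReal.tendsto _).comp h1).mul ?_
        refine (Complex.continuous_exp.tendsto _).comp ?_
        exact (((Complex.continuous_ofReal.tendsto _).comp hk.neg).const_mul _).mul_const _
      have e : ((rexp (-(1 / (2 + σ)) * (1 * v ^ 2)) : ℝ) : ℂ) *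
          Complex.exp (Complex.I * ((-y : ℝ) : ℂ) * v) =
          Complex.exp (Complex.I * ((-y : ℝ) : ℂ) * v) *
            Complex.exp (-((1 / (2 + σ) : ℝ) : ℂ) * v ^ 2) := by
        rw [mul_comm, Complex.ofReal_exp]; push_cast; ring_nf
      rw [e] at h2
      refine h2.congr' ?_
      have h3 := (tendsto_div_sqrt_natCast |v|).eventually (gt_mem_nhds pi_pos)
      filter_upwards [h3, eventually_gt_atTop 0] with L h3 hL
      have hs : 0 < √(L : ℝ) := by positivity
      rw [div_lt_iff₀ hs, mul_comm, abs_lt] at h3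
      simp only [hF]
      rw [indicator_of_mem (show v ∈ Ioc (-(√(L : ℝ) * π)) (√(L : ℝ) * π) from ⟨h3.1, h3.2.le⟩)]
  have hb0 : 0 < (((1 / (2 + σ) : ℝ) : ℂ)).re := by rw [Complex.ofReal_re]; positivity
  rw [fourierIntegral_gaussian hb0] at hint
  have hre := ((Complex.continuous_re.tendsto _).comp hint).const_mul (1 / (2 * π))
  have hval : 1 / (2 * π) * (((π : ℂ) / ((1 / (2 + σ) : ℝ) : ℂ)) ^ (1 / 2 : ℂ) *
      Complex.exp (-((-y : ℝ) : ℂ) ^ 2 / (4 * ((1 / (2 + σ) : ℝ) : ℂ)))).re =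
      √(2 + σ) / (2 * √π) * rexp (-(y ^ 2 * (2 + σ) / 4)) := by
    have e1 : ((π : ℂ) / ((1 / (2 + σ) : ℝ) : ℂ)) ^ (1 / 2 : ℂ) =
        ((√(π * (2 + σ)) : ℝ) : ℂ) := by
      rw [Real.sqrt_eq_rpow, Complex.ofReal_cpow (by positivity)]
      congr 1
      · push_cast; field_simp
      · push_cast; rfl
    have e2 : Complex.exp (-((-y : ℝ) : ℂ) ^ 2 / (4 * ((1 / (2 + σ) : ℝ) : ℂ))) =
        ((rexp (-(y ^ 2 * (2 + σ) / 4)) : ℝ) : ℂ) := by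
      rw [Complex.ofReal_exp]; congr 1; push_cast; field_simp
    rw [e1, e2, ← Complex.ofReal_mul, Complex.ofReal_re, Real.sqrt_mul pi_pos.le]
    nth_rewrite 1 [← Real.mul_self_sqrt pi_pos.le]
    have := Real.sqrt_pos.2 pi_pos
    field_simp
  rw [hval] at hre
  refine hre.congr' ?_
  filter_upwards [eventually_gt_atTop 0] with L hL
  have hs : 0 < √(L : ℝ) := by positivity
  have h1 := walkCoeff_eq_integral σ 0 L (k L)
  have h2 : ∫ v, F L v = ((√(L : ℝ) / (2 + σ) ^ L : ℝ) : ℂ) * ∫ y in (-π)..π,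
      ((σ : ℂ) + 2 * Complex.cosh ((0 : ℝ) + y * Complex.I)) ^ L *
        Complex.exp (-(k L : ℂ) * ((0 : ℝ) + y * Complex.I)) := by
    simp only [hF]
    rw [integral_indicator measurableSet_Ioc, ← intervalIntegral.integral_of_le (by
      have := mul_pos hs pi_pos; linarith)]
    have h3 := intervalIntegral.integral_comp_div (a := -(√(L : ℝ) * π)) (b := √(L : ℝ) * π)
      (fun y : ℝ => ((σ : ℂ) + 2 * Complex.cosh ((0 : ℝ) + y * Complex.I)) ^ L *
        Complex.exp (-(k L : ℂ) * ((0 : ℝ) + y * Complex.I))) hs.ne'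
    rw [neg_div, mul_div_cancel_left₀ _ hs.ne'] at h3
    have e : ((√(L : ℝ) / (2 + σ) ^ L : ℝ) : ℂ) = ((2 + σ : ℝ) : ℂ)⁻¹ ^ L * ((√(L : ℝ) : ℝ) : ℂ) := by
      push_cast; rw [inv_pow]; ring
    rw [e, mul_assoc, ← Complex.real_smul, ← h3, ← intervalIntegral.integral_const_mul]
    congr 1; funext v
    rw [Complex.ofReal_zero, zero_add, Complex.cosh_mul_I, ← mul_assoc, ← mul_pow]
    congr 2
    · push_cast; ring
    · push_cast; ring
  have h4 : (1 / (2 * π) : ℂ) * ∫ v, F L v =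
      ((√(L : ℝ) * walkCoeff σ L (k L) / (2 + σ) ^ L : ℝ) : ℂ) := by
    rw [h2, mul_left_comm, ← h1]; push_cast; ring
  have h5 := congrArg Complex.re h4
  rw [Complex.ofReal_re] at h5
  rw [← h5]
  have : (1 / (2 * π) : ℂ) = ((1 / (2 * π) : ℝ) : ℂ) := by push_cast; rfl
  rw [this, Complex.re_ofReal_mul]
  rfl

/-! ### Limit of the normalizing constant -/

theorem map_floor_mul_singleton {S : ℝ} (hS : 0 < S) (m : ℕ) :
    ((volume.restrict (Ioi (0 : ℝ))).map fun x => ⌊S * x⌋₊) {m} = ENNReal.ofReal (1 / S) := by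
  have hm : Measurable fun x : ℝ => ⌊S * x⌋₊ := Nat.measurable_floor.comp (by fun_prop)
  rw [Measure.map_apply hm (measurableSet_singleton m),
    Measure.restrict_congr_set Ioi_ae_eq_Ici, Measure.restrict_apply (hm (measurableSet_singleton m))]
  have : (fun x : ℝ => ⌊S * x⌋₊) ⁻¹' {m} ∩ Ici 0 = Ico (m / S) ((m + 1) / S) := by
    ext x
    simp only [mem_inter_iff, mem_preimage, mem_singleton_iff, mem_Ici, mem_Ico]
    rw [div_le_iff₀ hS, lt_div_iff₀ hS, mul_comm x S]
    constructor
    · rintro ⟨h, hx⟩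
      exact (Nat.floor_eq_iff (by positivity)).1 h
    · intro h
      have hx : 0 ≤ x := by
        have : 0 ≤ S * x := le_trans (Nat.cast_nonneg m) h.1
        exact nonneg_of_mul_nonneg_right this hS
      exact ⟨(Nat.floor_eq_iff (by positivity)).2 h, hx⟩
  rw [this, Real.volume_Ico]
  congr 1; ring

/-- Under the floor map the measure on the quadrant pushes forward to S⁻² times counting measure. A
double sum thus becomes the integral of a step function, to which dominated convergence applies. -/
theorem hasSum_of_integrable_floor {S : ℝ} (hS : 0 < S) {h : ℕ × ℕ → ℝ}
    (hi : Integrable (fun p : ℝ × ℝ => h (⌊S * p.1⌋₊, ⌊S * p.2⌋₊))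
      ((volume.restrict (Ioi 0)).prod (volume.restrict (Ioi 0)))) :
    HasSum h (S ^ 2 * ∫ p : ℝ × ℝ, h (⌊S * p.1⌋₊, ⌊S * p.2⌋₊)
      ∂((volume.restrict (Ioi 0)).prod (volume.restrict (Ioi 0)))) := by
  set μ : Measure ℝ := volume.restrict (Ioi 0) with hμ
  have hm : Measurable fun x : ℝ => ⌊S * x⌋₊ := Nat.measurable_floor.comp (by fun_prop)
  set f : ℝ → ℕ := fun x => ⌊S * x⌋₊ with hf
  have hmm : Measurable (Prod.map f f) := hm.prodMap hm
  set ν := (μ.prod μ).map (Prod.map f f) with hν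
  have hν' : ν = Measure.sum fun p : ℕ × ℕ => ENNReal.ofReal (1 / S ^ 2) • Measure.dirac p := by
    have h1 := Measure.map_prod_map μ μ hm hm
    have h2 : ∀ p : ℕ × ℕ, ν {p} = ENNReal.ofReal (1 / S ^ 2) := fun p => by
      rw [hν, ← h1, ← Set.singleton_prod_singleton (a := p.1) (b := p.2), Measure.prod_prod,
        map_floor_mul_singleton hS, map_floor_mul_singleton hS,
        ← ENNReal.ofReal_mul (by positivity)]
      congr 1; field_simp
    rw [← Measure.sum_smul_dirac ν]
    simp_rw [h2]
  have hsm : AEStronglyMeasurable h ν := (measurable_of_countable h).aestronglyMeasurable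
  have hiν : Integrable h ν := (integrable_map_measure hsm hmm.aemeasurable).2 hi
  have he : ∫ p : ℝ × ℝ, h (⌊S * p.1⌋₊, ⌊S * p.2⌋₊) ∂(μ.prod μ) = ∫ p, h p ∂ν :=
    (integral_map hmm.aemeasurable hsm).symm
  rw [he]
  rw [hν'] at hiν ⊢
  have := (hasSum_integral_measure hiν).mul_left (S ^ 2)
  refine this.of_eq (fun p => ?_) rfl
  rw [integral_smul_measure, integral_dirac, ENNReal.toReal_ofReal (by positivity), smul_eq_mul]
  field_simp

theorem floor_mul_sqrt_bounds {s x : ℝ} (hs : 0 ≤ s) (hx : 0 ≤ x) {L : ℕ} (hL : 0 < L) :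
    s * x - 1 ≤ (⌊s * √(L : ℝ) * x⌋₊ : ℝ) / √(L : ℝ) ∧
      (⌊s * √(L : ℝ) * x⌋₊ : ℝ) / √(L : ℝ) ≤ s * x := by
  have h1 : 1 ≤ √(L : ℝ) := by rw [Real.one_le_sqrt]; exact_mod_cast hL
  have h0 : 0 < √(L : ℝ) := by linarith
  constructor
  · rw [le_div_iff₀ h0]
    have := Nat.lt_floor_add_one (s * √(L : ℝ) * x)
    nlinarith
  · rw [div_le_iff₀ h0]
    exact (Nat.floor_le (by positivity)).trans_eq (by ring)

theorem tendsto_floor_mul_sqrt {s x : ℝ} (hs : 0 ≤ s) (hx : 0 ≤ x) :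
    Tendsto (fun L : ℕ => (⌊s * √(L : ℝ) * x⌋₊ : ℝ) / √(L : ℝ)) atTop (𝓝 (s * x)) := by
  have h := (tendsto_nat_floor_mul_div_atTop (mul_nonneg hs hx)).comp
    (Real.tendsto_sqrt_atTop.comp tendsto_natCast_atTop_atTop)
  refine h.congr fun L => ?_
  simp only [Function.comp_apply]
  rw [mul_right_comm]

theorem one_sub_div_sqrt_pow_le (c : ℝ) {t : ℝ} {L m : ℕ} (h0 : 0 ≤ 1 - c / √(L : ℝ))
    (h1 : t - 1 ≤ m / √(L : ℝ)) (h2 : m / √(L : ℝ) ≤ t) :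
    (1 - c / √(L : ℝ)) ^ m ≤ rexp (|c|) * rexp (-c * t) := by
  have h : 1 - c / √(L : ℝ) ≤ rexp (-(c / √(L : ℝ))) := by
    have := Real.add_one_le_exp (-(c / √(L : ℝ))); linarith
  calc (1 - c / √(L : ℝ)) ^ m ≤ rexp (-(c / √(L : ℝ))) ^ m := by gcongr
    _ = rexp (-(c * (m / √(L : ℝ)))) := by rw [← Real.exp_nat_mul]; congr 1; ring
    _ ≤ _ := by
      rw [← Real.exp_add]
      apply Real.exp_le_exp.2
      have h3 : |c * (m / √(L : ℝ) - t)| ≤ |c| := by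
        rw [abs_mul]
        exact mul_le_of_le_one_right (abs_nonneg _) (abs_le.2 ⟨by linarith, by linarith⟩)
      have := (abs_le.1 h3).1
      linarith

theorem tendsto_one_sub_div_sqrt_pow (c : ℝ) {N : ℕ → ℕ} {t : ℝ}
    (h : Tendsto (fun L : ℕ => (N L : ℝ) / √(L : ℝ)) atTop (𝓝 t)) :
    Tendsto (fun L : ℕ => (1 - c / √(L : ℝ)) ^ N L) atTop (𝓝 (rexp (-c * t))) := by
  refine tendsto_pow_exp ?_ ?_
  · simpa using (tendsto_div_sqrt_natCast c).const_sub 1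
  · refine (h.const_mul (-c)).congr fun L => by ring

theorem eventually_one_sub_div_sqrt_pos (c : ℝ) :
    ∀ᶠ L : ℕ in atTop, 0 < 1 - c / √(L : ℝ) := by
  have h : Tendsto (fun L : ℕ => 1 - c / √(L : ℝ)) atTop (𝓝 1) := by
    simpa using (tendsto_div_sqrt_natCast c).const_sub 1
  exact h.eventually (lt_mem_nhds one_pos)

/-- The total weight of the paths of length `L` from `m` to `m'`, including end-point weights. -/
noncomputable def pairWeight (a c σ : ℝ) (L : ℕ) (p : ℕ × ℕ) : ℝ :=
  (1 - c / √(L : ℝ)) ^ p.1 * (1 - a / √(L : ℝ)) ^ p.2 *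
    (walkCoeff σ L ((p.2 : ℤ) - p.1) - walkCoeff σ L ((p.2 : ℤ) + p.1 + 2))

/-- Write -cx - ay = -(a + c)(x + y)/2 - (c - a)(x - y)/2. The first term decays because a + c > 0
where the bound is used; the second is compensated by the decay of `walkCoeff` at rate K = |c - a|
in |x - y|. -/
theorem exists_abs_pairWeight_le {σ : ℝ} (hσ : 0 < σ) (a c : ℝ) {s : ℝ} (hs : 0 < s) :
    ∃ C, ∀ L : ℕ, 0 < L → 0 ≤ 1 - c / √(L : ℝ) → 0 ≤ 1 - a / √(L : ℝ) →
      ∀ x y : ℝ, 0 ≤ x → 0 ≤ y →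
      |√(L : ℝ) / (2 + σ) ^ L *
          pairWeight a c σ L (⌊s * √(L : ℝ) * x⌋₊, ⌊s * √(L : ℝ) * y⌋₊)| ≤
        C * (rexp (-(s * (a + c) / 2) * x) * rexp (-(s * (a + c) / 2) * y)) := by
  set K := |c - a| with hK
  have hK0 : 0 ≤ K := abs_nonneg _
  obtain ⟨C, hC, hb⟩ := exists_abs_walkCoeff_le hσ K
  refine ⟨rexp |c| * rexp |a| * (2 * (C * rexp (2 * K))), fun L hL hc ha x y hx hy => ?_⟩
  obtain ⟨hm1, hm2⟩ := floor_mul_sqrt_bounds hs.le hx hL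
  obtain ⟨hm1', hm2'⟩ := floor_mul_sqrt_bounds hs.le hy hL
  set m := ⌊s * √(L : ℝ) * x⌋₊
  set m' := ⌊s * √(L : ℝ) * y⌋₊
  have hsq : 0 < √(L : ℝ) := by positivity
  -- Rounding lowers each rescaled end-point by at most 1, so a loss of 2 covers both the difference
  -- and the sum of the altitudes.
  have hw : ∀ k : ℤ, s * |x - y| - 2 ≤ |(k : ℝ)| / √(L : ℝ) →
      √(L : ℝ) / (2 + σ) ^ L * |walkCoeff σ L k| ≤
        C * rexp (2 * K) * rexp (-(K * (s * |x - y|))) := fun k hk => by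
    rw [div_mul_eq_mul_div]
    refine (hb L hL k).trans ?_
    rw [mul_assoc, ← Real.exp_add, mul_div_assoc]
    gcongr
    have := mul_le_mul_of_nonneg_left hk hK0
    linarith
  have h1 := hw ((m' : ℤ) - m) (by
    have e : |(((m' : ℤ) - m : ℤ) : ℝ)| / √(L : ℝ) = |(m : ℝ) / √(L : ℝ) - m' / √(L : ℝ)| := by
      rw [← sub_div, abs_div, abs_of_pos hsq, abs_sub_comm]; push_cast; rfl
    rw [e]
    have : s * |x - y| = |s * x - s * y| := by rw [← mul_sub, abs_mul, abs_of_pos hs]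
    rw [this, sub_le_iff_le_add, abs_le]
    constructor <;> linarith [le_abs_self ((m : ℝ) / √(L : ℝ) - m' / √(L : ℝ)),
      neg_abs_le ((m : ℝ) / √(L : ℝ) - m' / √(L : ℝ))])
  have h2 := hw ((m' : ℤ) + m + 2) (by
    have e : |(((m' : ℤ) + m + 2 : ℤ) : ℝ)| / √(L : ℝ) =
        (m : ℝ) / √(L : ℝ) + m' / √(L : ℝ) + 2 / √(L : ℝ) := by
      push_cast
      rw [abs_of_nonneg (by positivity)]; ring
    rw [e]
    have : s * |x - y| ≤ s * x + s * y := by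
      rw [← mul_add]
      gcongr
      rw [abs_le]; constructor <;> linarith
    have : 0 ≤ 2 / √(L : ℝ) := by positivity
    linarith)
  have hsub : √(L : ℝ) / (2 + σ) ^ L *
      |walkCoeff σ L ((m' : ℤ) - m) - walkCoeff σ L ((m' : ℤ) + m + 2)| ≤
      2 * (C * rexp (2 * K)) * rexp (-(K * (s * |x - y|))) := by
    refine (mul_le_mul_of_nonneg_left (abs_sub _ _) (by positivity)).trans ?_
    rw [mul_add]; linarith
  have hp := one_sub_div_sqrt_pow_le c hc hm1 hm2
  have hp' := one_sub_div_sqrt_pow_le a ha hm1' hm2'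
  have e : |√(L : ℝ) / (2 + σ) ^ L * pairWeight a c σ L (m, m')| =
      (1 - c / √(L : ℝ)) ^ m * (1 - a / √(L : ℝ)) ^ m' * (√(L : ℝ) / (2 + σ) ^ L *
      |walkCoeff σ L ((m' : ℤ) - m) - walkCoeff σ L ((m' : ℤ) + m + 2)|) := by
    rw [pairWeight, abs_mul, abs_mul, abs_mul, abs_of_nonneg (pow_nonneg hc m),
      abs_of_nonneg (pow_nonneg ha m'), abs_of_nonneg (by positivity : 0 ≤ √(L : ℝ) / (2 + σ) ^ L)]
    ring
  rw [e]
  calc _ ≤ rexp (|c|) * rexp (-c * (s * x)) * (rexp (|a|) * rexp (-a * (s * y))) *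
        (2 * (C * rexp (2 * K)) * rexp (-(K * (s * |x - y|)))) := by gcongr
    _ = rexp |c| * rexp |a| * (2 * (C * rexp (2 * K))) *
        rexp (-c * (s * x) + -a * (s * y) + -(K * (s * |x - y|))) := by
      rw [Real.exp_add, Real.exp_add]; ring
    _ ≤ _ := by
      rw [← Real.exp_add (-(s * (a + c) / 2) * x)]
      refine mul_le_mul_of_nonneg_left (Real.exp_le_exp.2 ?_) (by positivity)
      have h3 : |(c - a) * (x - y)| = K * |x - y| := by rw [abs_mul]
      have h4 := neg_abs_le ((c - a) * (x - y))
      have h6 : 0 ≤ K * |x - y| := by positivity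
      have h5 : 0 ≤ s * ((c - a) * (x - y) / 2 + K * |x - y|) :=
        mul_nonneg hs.le (by rw [h3] at h4; linarith)
      linarith

/-- The scale √(2/(2 + σ)) is the standard deviation of a step with weights 1, σ, 1. In this unit
the two Gaussians from the local limit theorem form the killed kernel at time 1. -/
theorem tendsto_pairWeight {σ : ℝ} (hσ : 0 < σ) (a c : ℝ) {x y : ℝ} (hx : 0 < x) (hy : 0 < y) :
    Tendsto (fun L : ℕ => √(L : ℝ) / (2 + σ) ^ L * pairWeight a c σ L
      (⌊√(2 / (2 + σ)) * √(L : ℝ) * x⌋₊, ⌊√(2 / (2 + σ)) * √(L : ℝ) * y⌋₊)) atTop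
      (𝓝 (√((2 + σ) / 2) * (rexp (-(2 * c / √(2 + σ) * x + 2 * a / √(2 + σ) * y) / √2) *
        killedKernel 1 x y))) := by
  set s := √(2 / (2 + σ)) with hs
  have hs0 : 0 ≤ s := sqrt_nonneg _
  have h1 := tendsto_floor_mul_sqrt hs0 hx.le
  have h2 := tendsto_floor_mul_sqrt hs0 hy.le
  have hk1 : Tendsto (fun L : ℕ => (((⌊s * √(L : ℝ) * y⌋₊ : ℤ) - ⌊s * √(L : ℝ) * x⌋₊ : ℤ) : ℝ) /
      √(L : ℝ)) atTop (𝓝 (s * y - s * x)) := by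
    refine (h2.sub h1).congr fun L => ?_
    push_cast; ring
  have hk2 : Tendsto (fun L : ℕ => (((⌊s * √(L : ℝ) * y⌋₊ : ℤ) + ⌊s * √(L : ℝ) * x⌋₊ + 2 : ℤ) : ℝ) /
      √(L : ℝ)) atTop (𝓝 (s * y + s * x + 0)) := by
    refine ((h2.add h1).add (tendsto_div_sqrt_natCast 2)).congr fun L => ?_
    push_cast; ring
  have h := ((tendsto_one_sub_div_sqrt_pow c h1).mul (tendsto_one_sub_div_sqrt_pow a h2)).mul
    ((tendsto_walkCoeff hσ hk1).sub (tendsto_walkCoeff hσ hk2))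
  have hσ2 : 0 < 2 + σ := by positivity
  have hss : s ^ 2 = 2 / (2 + σ) := Real.sq_sqrt (by positivity)
  have e : rexp (-c * (s * x)) * rexp (-a * (s * y)) *
      (√(2 + σ) / (2 * √π) * rexp (-((s * y - s * x) ^ 2 * (2 + σ) / 4)) -
        √(2 + σ) / (2 * √π) * rexp (-((s * y + s * x + 0) ^ 2 * (2 + σ) / 4))) =
      √((2 + σ) / 2) * (rexp (-(2 * c / √(2 + σ) * x + 2 * a / √(2 + σ) * y) / √2) *
        killedKernel 1 x y) := by
    rw [killedKernel, if_pos ⟨hx, hy⟩]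
    have e1 : (s * y - s * x) ^ 2 * (2 + σ) / 4 = (x - y) ^ 2 / (2 * 1) := by
      rw [← mul_sub, mul_pow, hss]; field_simp; ring
    have e2 : (s * y + s * x + 0) ^ 2 * (2 + σ) / 4 = (x + y) ^ 2 / (2 * 1) := by
      rw [add_zero, ← mul_add, mul_pow, hss]; field_simp; ring
    have e3 : -(2 * c / √(2 + σ) * x + 2 * a / √(2 + σ) * y) / √2 =
        -c * (s * x) + -a * (s * y) := by
      have h2 : √2 * √2 = 2 := Real.mul_self_sqrt (by norm_num)
      rw [hs, Real.sqrt_div (by norm_num)]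
      have : √(2 + σ) ≠ 0 := by positivity
      field_simp
      rw [sq, h2]; ring
    have e4 : √((2 + σ) / 2) * (1 / √(2 * π * 1)) = √(2 + σ) / (2 * √π) := by
      have h2 : √2 * √2 = 2 := Real.mul_self_sqrt (by norm_num)
      rw [mul_one, Real.sqrt_div hσ2.le, Real.sqrt_mul (by norm_num), div_mul_div_comm, mul_one,
        ← mul_assoc, h2]
    rw [e1, e2, e3, Real.exp_add, ← e4, neg_div, neg_div]; ring
  rw [e] at h
  refine h.congr fun L => ?_
  rw [pairWeight]; ring

theorem boundaryConst_integrable_and_tendsto {a c σ : ℝ} (hac : 0 < a + c) (hσ : 0 < σ) :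
    0 < boundaryConst (2 * a / √(2 + σ)) (2 * c / √(2 + σ)) ∧
    (∀ᶠ L : ℕ in atTop, Summable (pairWeight a c σ L)) ∧
    Tendsto (fun L : ℕ => (∑' p, pairWeight a c σ L p) / (√(L : ℝ) * (2 + σ) ^ L)) atTop
      (𝓝 (√(2 / (2 + σ)) * boundaryConst (2 * a / √(2 + σ)) (2 * c / √(2 + σ)))) := by
  set s := √(2 / (2 + σ)) with hs
  have hs0 : 0 < s := Real.sqrt_pos.2 (by positivity)
  set μ : Measure (ℝ × ℝ) := (volume.restrict (Ioi 0)).prod (volume.restrict (Ioi 0)) with hμ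
  have hμr : μ = volume.restrict (Ioi 0 ×ˢ Ioi 0) := by
    rw [hμ, Measure.prod_restrict, ← Measure.volume_eq_prod]
  have hms : MeasurableSet (Ioi (0 : ℝ) ×ˢ Ioi (0 : ℝ)) := measurableSet_Ioi.prod measurableSet_Ioi
  have hae : ∀ᵐ p ∂μ, 0 < p.1 ∧ 0 < p.2 := by
    rw [hμr]; exact (ae_restrict_mem hms).mono fun p hp => hp
  obtain ⟨C, hC⟩ := exists_abs_pairWeight_le hσ a c hs0
  set F : ℕ → ℝ × ℝ → ℝ := fun L p => √(L : ℝ) / (2 + σ) ^ L *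
    pairWeight a c σ L (⌊s * √(L : ℝ) * p.1⌋₊, ⌊s * √(L : ℝ) * p.2⌋₊) with hF
  set G : ℝ × ℝ → ℝ := fun p =>
    rexp (-(2 * c / √(2 + σ) * p.1 + 2 * a / √(2 + σ) * p.2) / √2) * killedKernel 1 p.1 p.2 with hG
  set bound : ℝ × ℝ → ℝ := fun p =>
    C * (rexp (-(s * (a + c) / 2) * p.1) * rexp (-(s * (a + c) / 2) * p.2)) with hbd
  have hbi : Integrable bound μ := by
    have h1 : IntegrableOn (fun x => rexp (-(s * (a + c) / 2) * x)) (Ioi 0) :=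
      exp_neg_integrableOn_Ioi 0 (by positivity)
    exact (Integrable.mul_prod h1 h1).const_mul C
  have hmeas : ∀ L, Measurable (F L) := fun L => by
    have : Measurable fun p : ℝ × ℝ => (⌊s * √(L : ℝ) * p.1⌋₊, ⌊s * √(L : ℝ) * p.2⌋₊) :=
      (Nat.measurable_floor.comp (by fun_prop)).prodMk (Nat.measurable_floor.comp (by fun_prop))
    exact ((measurable_of_countable (pairWeight a c σ L)).comp this).const_mul _
  have hle : ∀ᶠ L in atTop, ∀ᵐ p ∂μ, ‖F L p‖ ≤ bound p := by
    filter_upwards [eventually_one_sub_div_sqrt_pos c, eventually_one_sub_div_sqrt_pos a,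
      eventually_gt_atTop 0] with L h1 h2 hL
    filter_upwards [hae] with p hp
    exact hC L hL h1.le h2.le p.1 p.2 hp.1.le hp.2.le
  have hlim : ∀ᵐ p ∂μ, Tendsto (fun L => F L p) atTop (𝓝 (√((2 + σ) / 2) * G p)) := by
    filter_upwards [hae] with p hp
    exact tendsto_pairWeight hσ a c hp.1 hp.2
  -- The Jacobian of the rescaling against the prefactor of the pointwise limit.
  have hss : s ^ 2 * √((2 + σ) / 2) = s := by
    have : s * √((2 + σ) / 2) = 1 := by
      rw [hs, ← Real.sqrt_mul (by positivity), show 2 / (2 + σ) * ((2 + σ) / 2) = 1 by field_simp,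
        Real.sqrt_one]
    rw [sq, mul_assoc, this, mul_one]
  have hGi : Integrable G μ := by
    have h1 : Integrable (fun p => √((2 + σ) / 2) * G p) μ := by
      refine hbi.mono' (aestronglyMeasurable_of_tendsto_ae atTop
        (fun L => (hmeas L).aestronglyMeasurable) hlim) ?_
      obtain ⟨L₀, hL₀⟩ := eventually_atTop.1 hle
      have hall : ∀ᵐ u ∂μ, ∀ L ≥ L₀, ‖F L u‖ ≤ bound u := by
        rw [ae_all_iff]; intro L
        by_cases h : L ≥ L₀
        · filter_upwards [hL₀ L h] with u hu _ using hu
        · exact ae_of_all _ fun u h' => absurd h' h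
      filter_upwards [hall, hlim] with u h1 h2
      exact le_of_tendsto h2.norm (eventually_atTop.2 ⟨L₀, h1⟩)
    refine (h1.const_mul (s ^ 2 / s)).congr (ae_of_all _ fun p => ?_)
    simp only
    rw [← mul_assoc, div_mul_eq_mul_div, hss, div_self hs0.ne', one_mul]
  have hbc : boundaryConst (2 * a / √(2 + σ)) (2 * c / √(2 + σ)) = ∫ p, G p ∂μ := by
    rw [boundaryConst, hμr]
  have hsum : ∀ᶠ L : ℕ in atTop, HasSum (pairWeight a c σ L)
      ((s * √(L : ℝ)) ^ 2 * ((√(L : ℝ) / (2 + σ) ^ L)⁻¹ * ∫ p, F L p ∂μ)) := by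
    filter_upwards [hle, eventually_gt_atTop 0] with L h hL
    have hsq : 0 < √(L : ℝ) := by positivity
    have hne : √(L : ℝ) / (2 + σ) ^ L ≠ 0 := by positivity
    have hi : Integrable (F L) μ := hbi.mono' (hmeas L).aestronglyMeasurable h
    have e : ∀ p : ℝ × ℝ, pairWeight a c σ L (⌊s * √(L : ℝ) * p.1⌋₊, ⌊s * √(L : ℝ) * p.2⌋₊) =
        (√(L : ℝ) / (2 + σ) ^ L)⁻¹ * F L p := fun p => by
      rw [hF]; simp only; rw [inv_mul_cancel_left₀ hne]
    have h1 := hasSum_of_integrable_floor (S := s * √(L : ℝ)) (by positivity)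
      (h := pairWeight a c σ L) (by
        simp_rw [e]; exact hi.const_mul _)
    simp_rw [e] at h1
    rwa [integral_const_mul] at h1
  refine ⟨?_, hsum.mono fun L h => h.summable, ?_⟩
  · rw [hbc, hμr]
    have hpos : ∀ p ∈ Ioi (0 : ℝ) ×ˢ Ioi (0 : ℝ), 0 < G p := fun p hp => by
      have h1 : 0 < p.1 := hp.1
      have h2 : 0 < p.2 := hp.2
      refine mul_pos (Real.exp_pos _) ?_
      rw [killedKernel, if_pos ⟨h1, h2⟩]
      refine mul_pos (by positivity) (sub_pos.2 (Real.exp_lt_exp.2 ?_))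
      rw [div_lt_div_iff_of_pos_right (by norm_num)]
      nlinarith [mul_pos h1 h2]
    rw [setIntegral_pos_iff_support_of_nonneg_ae
      ((ae_restrict_mem hms).mono fun p hp => (hpos p hp).le) (by rw [IntegrableOn, ← hμr]; exact hGi)]
    have : Function.support G ∩ Ioi (0 : ℝ) ×ˢ Ioi (0 : ℝ) = Ioi (0 : ℝ) ×ˢ Ioi (0 : ℝ) :=
      inter_eq_right.2 fun p hp => (hpos p hp).ne'
    rw [this, Measure.volume_eq_prod, Measure.prod_prod]
    simp
  · have h := (tendsto_integral_filter_of_dominated_convergence bound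
      (.of_forall fun L => (hmeas L).aestronglyMeasurable) hle hbi hlim).const_mul (s ^ 2)
    rw [integral_const_mul, ← mul_assoc, hss, ← hbc] at h
    refine h.congr' ?_
    filter_upwards [hsum, eventually_gt_atTop 0] with L h hL
    have hsq : 0 < √(L : ℝ) := by positivity
    rw [h.tsum_eq]
    have : (0 : ℝ) < (2 + σ) ^ L := by positivity
    field_simp

/-! ### Real path sums -/

theorem hasSum_of_tsum_ofReal {ι : Type*} {f : ι → ℝ} {T : ℝ} (hf : ∀ i, 0 ≤ f i) (hT : 0 ≤ T)
    (h : ∑' i, ENNReal.ofReal (f i) = ENNReal.ofReal T) : HasSum f T := by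
  have hs : Summable f := by
    refine (ENNReal.summable_toReal (h.trans_ne ENNReal.ofReal_ne_top)).congr fun i => ?_
    exact ENNReal.toReal_ofReal (hf i)
  have ht : ∑' i, f i = T := by
    have := ENNReal.ofReal_tsum_of_nonneg hf hs
    rw [h] at this
    exact (ENNReal.ofReal_eq_ofReal_iff (tsum_nonneg hf) hT).1 this
  exact ht ▸ hs.hasSum

theorem blockFun_nonneg {r s : ℕ → ℝ} (hr : ∀ k, 0 ≤ r k) (hs : ∀ k, 0 ≤ s k) (N : ℕ → ℕ)
    (k m : ℕ) : 0 ≤ blockFun r s N k m := by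
  induction k generalizing m with
  | zero => exact pow_nonneg (hr 0) m
  | succ k ih =>
    refine mul_nonneg (pow_nonneg (hr _) m) ?_
    have : ∀ (i m : ℕ), 0 ≤ (motzkinStep (s k))^[i] (blockFun r s N k) m := by
      intro i
      induction i with
      | zero => exact ih
      | succ i ih' =>
        intro m
        rw [Function.iterate_succ_apply']
        exact motzkinStep_nonneg (hs k) ih' m
    exact this _ m

theorem endRatio_nonneg {n : ℕ} {ρ₀ ρ₁ : ℝ} (h₀ : 0 ≤ ρ₀) (h₁ : 0 ≤ ρ₁) (q : Fin (n + 2) → ℝ)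
    (k : Fin (n + 2)) : 0 ≤ endRatio ρ₀ ρ₁ q k := by
  unfold endRatio
  refine mul_nonneg (mul_nonneg ?_ ?_) (Real.exp_pos _).le
  · split_ifs <;> [exact h₀; exact zero_le_one]
  · split_ifs <;> [exact h₁; exact zero_le_one]

theorem MotzkinPath.weight_nonneg {a c σ : ℝ} (hσ : 0 ≤ σ) {L : ℕ} (hc : 0 ≤ 1 - c / √(L : ℝ))
    (ha : 0 ≤ 1 - a / √(L : ℝ)) (γ : MotzkinPath L) : 0 ≤ γ.weight a c σ :=
  mul_nonneg (mul_nonneg (pow_nonneg hc _) (pow_nonneg hσ _)) (pow_nonneg ha _)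

theorem hasSum_weight_mul_motzkinExp {a c σ : ℝ} {n L : ℕ} {x : Fin (n + 2) → ℝ}
    {τ : Fin (n + 2) → ℕ} (hσ : 0 ≤ σ) (hc : 0 ≤ 1 - c / √(L : ℝ))
    (ha : 0 ≤ 1 - a / √(L : ℝ)) (q : Fin (n + 2) → ℝ) (θ : Fin (n + 1) → ℝ)
    (hτ : ∀ k, τ k = ⌊(L : ℝ) * x k⌋₊) (hm : StrictMono τ) (h0 : τ 0 = 0)
    (hL : τ (Fin.last (n + 1)) = L) {T : ℝ} (hT : HasSum (blockFun
          (fun k => endRatio (1 - c / √L) (1 - a / √L) q (Fin.ofNat (n + 2) k))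
          (fun k => σ * rexp (∑ i ∈ Finset.Ici (Fin.ofNat (n + 1) k), θ i))
          (fun k => τ (Fin.ofNat (n + 2) (k + 1)) - τ (Fin.ofNat (n + 2) k)) (n + 1)) T) :
    HasSum (fun γ : MotzkinPath L => γ.weight a c σ * motzkinExp σ x L q θ γ)
      (rexp (-(σ / (2 + σ) * ∑ k : Fin (n + 1), θ k * τ k.succ)) * T) := by
  have hb := blockFun_nonneg
    (r := fun k => endRatio (1 - c / √L) (1 - a / √L) q (Fin.ofNat (n + 2) k))
    (s := fun k => σ * rexp (∑ i ∈ Finset.Ici (Fin.ofNat (n + 1) k), θ i))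
    (fun k => endRatio_nonneg hc ha q _) (fun k => mul_nonneg hσ (Real.exp_pos _).le)
    (fun k => τ (Fin.ofNat (n + 2) (k + 1)) - τ (Fin.ofNat (n + 2) k)) (n + 1)
  have hT0 : 0 ≤ T := hT.nonneg hb
  refine hasSum_of_tsum_ofReal
    (fun γ => mul_nonneg (γ.weight_nonneg hσ hc ha) (Real.exp_pos _).le) (by positivity) ?_
  rw [tsum_weight_mul_motzkinExp hσ hc ha q θ hτ hm h0 hL, ENNReal.ofReal_mul (Real.exp_pos _).le,
    ← ENNReal.ofReal_tsum_of_nonneg hb hT.summable, hT.tsum_eq]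

/-- The case of a single block with q = 0 and θ = 0, evaluated by reflection rather than spectrally,
so that end ratios of 1 or more are allowed. -/
theorem hasSum_weight {a c σ : ℝ} {L : ℕ} (hL : 0 < L) (hσ : 0 ≤ σ) (hc : 0 ≤ 1 - c / √(L : ℝ))
    (ha : 0 ≤ 1 - a / √(L : ℝ)) (hs : Summable (pairWeight a c σ L)) :
    HasSum (fun γ : MotzkinPath L => γ.weight a c σ) (∑' p, pairWeight a c σ L p) := by
  have h := hasSum_weight_mul_motzkinExp (n := 0) (x := ![0, 1]) (τ := ![0, L]) hσ hc ha 0 0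
    (by intro k; fin_cases k <;> simp)
    (by rw [Fin.strictMono_iff_lt_succ]; intro k; fin_cases k; simpa using hL) rfl rfl
    (T := ∑' p, pairWeight a c σ L p) (by
      -- `pairWeight` lists the starting altitude first, while the fibres are taken over the final
      -- one.
      have h1 := (Equiv.prodComm ℕ ℕ).hasSum_iff.2 hs.hasSum
      refine h1.prod_fiberwise fun m => ?_
      have h2 := (hasSum_iterate_motzkinStep σ (1 - c / √(L : ℝ)) L m).mul_left
        ((1 - a / √(L : ℝ)) ^ m)
      refine h2.of_eq (fun m' => ?_) ?_
      · simp [pairWeight]; ring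
      · simp [blockFun, endRatio])
  refine h.of_eq (fun γ => ?_) ?_
  · simp [motzkinExp]
  · simp

/-! ### Summation by parts and limits of the parameters -/

theorem sum_Iic_sub {n : ℕ} (t : Fin (n + 2) → ℝ) (j : Fin (n + 1)) :
    ∑ i ∈ Finset.Iic j, (t i.succ - t i.castSucc) = t j.succ - t 0 := by
  induction j using Fin.induction with
  | zero =>
    have : Finset.Iic (0 : Fin (n + 1)) = {0} := by ext i; simp
    rw [this, Finset.sum_singleton]; rfl
  | succ j ih =>
    have : Finset.Iic j.succ = insert j.succ (Finset.Iic j.castSucc) := by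
      ext i; simp only [Finset.mem_Iic, Finset.mem_insert, Fin.le_def, Fin.ext_iff, Fin.val_succ,
        Fin.val_castSucc]; omega
    rw [this, Finset.sum_insert (by simp [Fin.le_def]), ih, Fin.succ_castSucc]; ring

theorem sum_sub_eq {n : ℕ} (t : Fin (n + 2) → ℝ) :
    ∑ i : Fin (n + 1), (t i.succ - t i.castSucc) = t (Fin.last (n + 1)) - t 0 := by
  have := sum_Iic_sub t (Fin.last n)
  rwa [show Finset.Iic (Fin.last n) = Finset.univ by ext i; simp [Fin.le_last]] at this

/-- Abel summation; it distributes the centring term over the blocks, with the tail sums of θ as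
coefficients. -/
theorem sum_mul_succ_eq {n : ℕ} (t : Fin (n + 2) → ℝ) (h0 : t 0 = 0) (θ : Fin (n + 1) → ℝ) :
    ∑ k : Fin (n + 1), θ k * t k.succ =
      ∑ i : Fin (n + 1), (t i.succ - t i.castSucc) * ∑ j ∈ Finset.Ici i, θ j := by
  have h : ∀ k : Fin (n + 1), θ k * t k.succ =
      ∑ i ∈ Finset.Iic k, (t i.succ - t i.castSucc) * θ k := fun k => by
    rw [← Finset.sum_mul, sum_Iic_sub, h0]; ring
  simp_rw [h, Finset.mul_sum]
  refine Finset.sum_comm' fun i j => by simp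

/-- 1 - AB = (1 - A) + A(1 - B), and A tends to 1. -/
theorem tendsto_sqrt_mul_one_sub_mul {A B : ℕ → ℝ} {α β : ℝ}
    (hA : Tendsto (fun L : ℕ => √(L : ℝ) * (1 - A L)) atTop (𝓝 α))
    (hB : Tendsto (fun L : ℕ => √(L : ℝ) * (1 - B L)) atTop (𝓝 β)) :
    Tendsto (fun L : ℕ => √(L : ℝ) * (1 - A L * B L)) atTop (𝓝 (α + β)) := by
  have h := hA.add ((tendsto_one_of_tendsto_sqrt_mul hA).mul hB)
  rw [one_mul] at h
  refine h.congr fun L => by ring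

/-- The limit of `√L (1 - r)` for the ratio `r` at the `k`-th marked time. -/
noncomputable def endRate {n : ℕ} (a c : ℝ) (q : Fin (n + 2) → ℝ) (k : Fin (n + 2)) : ℝ :=
  (if k = 0 then c else 0) + (if k = Fin.last (n + 1) then a else 0) + q k

theorem tendsto_endRatio {n : ℕ} (a c : ℝ) (q : Fin (n + 2) → ℝ) (k : Fin (n + 2)) :
    Tendsto (fun L : ℕ => √(L : ℝ) * (1 - endRatio (1 - c / √(L : ℝ)) (1 - a / √(L : ℝ))
      (fun k => q k / √(L : ℝ)) k)) atTop (𝓝 (endRate a c q k)) := by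
  have hsq : ∀ b : ℝ, Tendsto (fun L : ℕ => √(L : ℝ) * (1 - (1 - b / √(L : ℝ)))) atTop (𝓝 b) := by
    intro b
    refine tendsto_const_nhds.congr' ?_
    filter_upwards [eventually_gt_atTop 0] with L hL
    have : √(L : ℝ) ≠ 0 := by positivity
    field_simp; ring
  have hite : ∀ (P : Prop) [Decidable P] (b : ℝ), Tendsto (fun L : ℕ => √(L : ℝ) *
      (1 - if P then 1 - b / √(L : ℝ) else 1)) atTop (𝓝 (if P then b else 0)) := by
    intro P _ b
    split_ifs
    · exact hsq b
    · simp
  refine tendsto_sqrt_mul_one_sub_mul (tendsto_sqrt_mul_one_sub_mul (hite _ c) (hite _ a)) ?_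
  have h := (tendsto_sqrt_mul_exp_sub_one (-q k)).neg
  rw [neg_neg] at h
  refine h.congr fun L => ?_
  rw [neg_div]; ring

theorem endRate_pos {n : ℕ} {a c : ℝ} {q : Fin (n + 2) → ℝ} (hq : ∀ k, 0 < q k)
    (hq0 : 0 < c + q 0) (hqd : 0 < a + q (Fin.last (n + 1))) (k : Fin (n + 2)) :
    0 < endRate a c q k := by
  have hne : (0 : Fin (n + 2)) ≠ Fin.last (n + 1) := (Fin.last_pos).ne
  unfold endRate
  by_cases h0 : k = 0
  · subst h0; rw [if_pos rfl, if_neg hne]; linarith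
  · by_cases h1 : k = Fin.last (n + 1)
    · subst h1; rw [if_pos rfl, if_neg h0]; linarith
    · rw [if_neg h0, if_neg h1]; linarith [hq k]

/-- The centred tilt of a block contributes a Gaussian factor. -/
theorem tendsto_tilt_pow {σ : ℝ} (hσ : 0 < σ) (S : ℝ) {N : ℕ → ℕ} {Δ : ℝ}
    (hN : Tendsto (fun L => (N L : ℝ) / L) atTop (𝓝 Δ)) :
    Tendsto (fun L : ℕ => (rexp (-(σ / (2 + σ) * (S / √(L : ℝ)))) *
      ((2 + σ * rexp (S / √(L : ℝ))) / (2 + σ))) ^ N L) atTop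
      (𝓝 (rexp (σ / (2 + σ) ^ 2 * (Δ * S ^ 2)))) := by
  have hσ2 : 2 + σ ≠ 0 := by positivity
  set p := σ / (2 + σ) with hp
  have hp1 : 2 / (2 + σ) = 1 - p := by rw [hp]; field_simp; ring
  -- This is the Laplace transform of a centred Bernoulli(p) variable at S/√L. The first-order terms
  -- cancel, and half the variance is p(1 - p)/2 = σ/(2 + σ)².
  have e : ∀ L : ℕ, rexp (-(p * (S / √(L : ℝ)))) * ((2 + σ * rexp (S / √(L : ℝ))) / (2 + σ)) =
      (1 - p) * rexp (-(p * S) / √(L : ℝ)) + p * rexp ((1 - p) * S / √(L : ℝ)) := fun L => by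
    have h1 : rexp ((1 - p) * S / √(L : ℝ)) =
        rexp (-(p * S) / √(L : ℝ)) * rexp (S / √(L : ℝ)) := by
      rw [← Real.exp_add]; congr 1; ring
    rw [h1, add_div, hp1, mul_div_right_comm, ← hp, ← mul_div_assoc, neg_div]; ring
  simp_rw [e]
  have hexp : ∀ y : ℝ, Tendsto (fun L : ℕ => rexp (y / √(L : ℝ))) atTop (𝓝 1) := fun y => by
    simpa [Function.comp_def] using
      (Real.continuous_exp.tendsto 0).comp (tendsto_div_sqrt_natCast y)
  refine tendsto_pow_exp ?_ ?_
  · have := ((hexp (-(p * S))).const_mul (1 - p)).add ((hexp ((1 - p) * S)).const_mul p)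
    rwa [show (1 - p) * 1 + p * 1 = 1 by ring] at this
  · have h := hN.mul (((tendsto_mul_exp_sub (-(p * S))).const_mul (1 - p)).add
      ((tendsto_mul_exp_sub ((1 - p) * S)).const_mul p))
    have hval : Δ * ((1 - p) * ((-(p * S)) ^ 2 / 2) + p * (((1 - p) * S) ^ 2 / 2)) =
        σ / (2 + σ) ^ 2 * (Δ * S ^ 2) := by
      have : σ / (2 + σ) ^ 2 = p * (1 - p) / 2 := by rw [← hp1, hp]; field_simp
      rw [this]; ring
    rw [hval] at h
    refine h.congr' ?_
    filter_upwards [eventually_gt_atTop 0] with L hL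
    have : (L : ℝ) ≠ 0 := by positivity
    field_simp
    ring

/-! ### Identification of the limit and conclusion -/

theorem setOf_forall_pos_eq (n : ℕ) :
    {u : Fin (n + 1) → ℝ | ∀ k, 0 < u k} = univ.pi fun _ => Ioi 0 := by
  ext u; simp

theorem restrict_forall_pos (n : ℕ) :
    (volume : Measure (Fin (n + 1) → ℝ)).restrict {u | ∀ k, 0 < u k} =
      Measure.pi fun _ => volume.restrict (Ioi 0) := by
  rw [setOf_forall_pos_eq, volume_pi, Measure.restrict_pi_pi]

theorem ofNat_val {n : ℕ} (i : Fin (n + 1)) : Fin.ofNat (n + 1) i = i := by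
  ext; simp

theorem ofNat_castSucc {n : ℕ} (i : Fin (n + 1)) : Fin.ofNat (n + 2) i = i.castSucc := by
  ext; simp

theorem ofNat_succ {n : ℕ} (i : Fin (n + 1)) : Fin.ofNat (n + 2) (i + 1) = i.succ := by
  ext; simp; omega

theorem chainLimit_eq {n : ℕ} {a c σ : ℝ} {x q : Fin (n + 2) → ℝ} {T Δ : ℕ → ℝ}
    (hT : ∀ k, T k = endRate a c q (Fin.ofNat (n + 2) k))
    (hΔ : ∀ i : Fin (n + 1), Δ i = x i.succ - x i.castSucc) {u : Fin (n + 1) → ℝ}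
    (hu : ∀ k, 0 < u k) : chainLimit σ T Δ n u = 1 / π * limitIntegrand a c σ x q u := by
  have hne : (0 : Fin (n + 2)) ≠ Fin.last (n + 1) := (Fin.last_pos).ne
  have hT0 : T 0 = c + q 0 := by
    rw [hT, show Fin.ofNat (n + 2) 0 = 0 from rfl, endRate, if_pos rfl, if_neg hne, add_zero]
  have hTl : T (n + 1) = a + q (Fin.last (n + 1)) := by
    have : Fin.ofNat (n + 2) (n + 1) = Fin.last (n + 1) := by ext; simp
    rw [hT, this, endRate, if_neg hne.symm, if_pos rfl, zero_add]
  have hTi : ∀ i : Fin n, T (i + 1) = q i.succ.castSucc := fun i => by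
    have : Fin.ofNat (n + 2) (i + 1) = i.succ.castSucc := by ext; simp
    rw [hT, this, endRate, if_neg, if_neg, zero_add, zero_add]
    · intro h; have := congrArg Fin.val h; simp at this; omega
    · intro h; have := congrArg Fin.val h; simp at this
  have hexp : ∏ i : Fin (n + 1), rexp (-(1 / (2 + σ)) * (Δ i * u i)) =
      rexp (-(1 / (2 + σ)) * ∑ k : Fin (n + 1), (x k.succ - x k.castSucc) * u k) := by
    rw [← Real.exp_sum, Finset.mul_sum]
    simp_rw [hΔ]
  -- The factors π√u_i of the kernels cancel all the densities but the last, whose √u_d is cancelled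
  -- by the end-point factor; only 1/π remains.
  have hsq : (∏ i : Fin (n + 1), 1 / (π * √(u i))) * √(u (Fin.last n)) *
      ∏ i : Fin n, π * √(u i.castSucc) = 1 / π := by
    have h1 : √(u (Fin.last n)) ≠ 0 := (Real.sqrt_pos.2 (hu _)).ne'
    have h2 : (∏ i : Fin n, 1 / (π * √(u i.castSucc))) * ∏ i : Fin n, π * √(u i.castSucc) = 1 := by
      rw [← Finset.prod_mul_distrib]
      refine Finset.prod_eq_one fun i _ => ?_
      have := (Real.sqrt_pos.2 (hu i.castSucc)).ne'
      field_simp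
    rw [Fin.prod_univ_castSucc]
    have e : 1 / (π * √(u (Fin.last n))) * √(u (Fin.last n)) = 1 / π := by field_simp
    rw [mul_assoc (∏ i : Fin n, 1 / (π * √(u i.castSucc))), e, mul_right_comm, h2, one_mul]
  rw [chainLimit, limitIntegrand, Finset.prod_mul_distrib, Finset.prod_mul_distrib, hexp, hT0, hTl,
    ← hsq]
  simp_rw [hTi]
  ring

/-- Here `d = n + 1 ≥ 1`, the vector `q` is `(c_0, …, c_d)`, and `θ k` is `θ_{k+1}`. -/
theorem proposition3p1 (a c σ : ℝ) (hac : 0 < a + c) (hσ : 0 < σ)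
    (n : ℕ) (x : Fin (n + 2) → ℝ) (hx : StrictMono x)
    (hx0 : x 0 = 0) (hx1 : x (Fin.last (n + 1)) = 1)
    (q : Fin (n + 2) → ℝ) (θ : Fin (n + 1) → ℝ) (hq : ∀ k, 0 < q k)
    (hq0 : 0 < c + q 0) (hqd : 0 < a + q (Fin.last (n + 1))) :
    (∀ᶠ L : ℕ in atTop, IsProbabilityMeasure (motzkinLaw a c σ L) ∧
      Integrable (motzkinExp σ x L (fun k => q k / √(L : ℝ)) (fun k => θ k / √(L : ℝ)))
        (motzkinLaw a c σ L)) ∧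
    0 < boundaryConst (2 * a / √(2 + σ)) (2 * c / √(2 + σ)) ∧
    IntegrableOn (limitIntegrand a c σ x q) {u : Fin (n + 1) → ℝ | ∀ k, 0 < u k} ∧
    Tendsto
      (fun L : ℕ => motzkinLaplace a c σ x L
        (fun k => q k / √(L : ℝ)) (fun k => θ k / √(L : ℝ)))
      atTop
      (𝓝 (limitPsi a c σ x q *
        Real.exp (σ / (2 + σ) ^ 2 *
          ∑ k : Fin (n + 1),
            (x k.succ - x k.castSucc) * (∑ j ∈ Finset.Ici k, θ j) ^ 2))) := by
  obtain ⟨hK, hsumC, hlimC⟩ := boundaryConst_integrable_and_tendsto hac hσ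
  set 𝔎 := boundaryConst (2 * a / √(2 + σ)) (2 * c / √(2 + σ)) with h𝔎
  set s₀ := √(2 / (2 + σ)) with hs₀
  have hs₀0 : 0 < s₀ := Real.sqrt_pos.2 (by positivity)
  have hx_nonneg : ∀ k, 0 ≤ x k := fun k => hx0 ▸ hx.monotone (Fin.zero_le k)
  -- the marked times
  set τ : ℕ → Fin (n + 2) → ℕ := fun L k => ⌊(L : ℝ) * x k⌋₊ with hτ
  have hτmono : ∀ L, Monotone (τ L) := fun L i j hij =>
    Nat.floor_le_floor (mul_le_mul_of_nonneg_left (hx.monotone hij) (Nat.cast_nonneg L))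
  have hτ0 : ∀ L, τ L 0 = 0 := fun L => by simp [hτ, hx0]
  have hτ1 : ∀ L, τ L (Fin.last (n + 1)) = L := fun L => by simp [hτ, hx1]
  have hτlim : ∀ k, Tendsto (fun L => (τ L k : ℝ) / L) atTop (𝓝 (x k)) := fun k => by
    refine ((tendsto_nat_floor_mul_div_atTop (hx_nonneg k)).comp
      tendsto_natCast_atTop_atTop).congr fun L => ?_
    simp only [Function.comp_apply, hτ]
    rw [mul_comm (x k)]
  have hNlim : ∀ i : Fin (n + 1), Tendsto (fun L => ((τ L i.succ - τ L i.castSucc : ℕ) : ℝ) / L)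
      atTop (𝓝 (x i.succ - x i.castSucc)) := fun i => by
    refine ((hτlim i.succ).sub (hτlim i.castSucc)).congr fun L => ?_
    rw [Nat.cast_sub (hτmono L i.castSucc_lt_succ.le)]; ring
  have hΔ : ∀ i : Fin (n + 1), 0 < x i.succ - x i.castSucc := fun i =>
    sub_pos.2 (hx i.castSucc_lt_succ)
  -- The marked times are distinct once every block length divided by L is close to its positive
  -- limit.
  have hτstrict : ∀ᶠ L in atTop, StrictMono (τ L) := by
    have : ∀ᶠ L in atTop, ∀ i : Fin (n + 1),
        0 < ((τ L i.succ - τ L i.castSucc : ℕ) : ℝ) / L :=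
      eventually_all.2 fun i => (hNlim i).eventually (lt_mem_nhds (hΔ i))
    filter_upwards [this] with L h
    rw [Fin.strictMono_iff_lt_succ]
    intro i
    by_contra hle
    have h0 : τ L i.succ - τ L i.castSucc = 0 := by omega
    have := h i
    rw [h0] at this
    simp at this
  -- the parameters of the blocks
  set r : ℕ → ℕ → ℝ := fun L k => endRatio (1 - c / √(L : ℝ)) (1 - a / √(L : ℝ))
    (fun k => q k / √(L : ℝ)) (Fin.ofNat (n + 2) k) with hr
  set s : ℕ → ℕ → ℝ := fun L k =>
    σ * rexp (∑ i ∈ Finset.Ici (Fin.ofNat (n + 1) k), θ i / √(L : ℝ)) with hs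
  set N : ℕ → ℕ → ℕ := fun L k =>
    τ L (Fin.ofNat (n + 2) (k + 1)) - τ L (Fin.ofNat (n + 2) k) with hN
  set T : ℕ → ℝ := fun k => endRate a c q (Fin.ofNat (n + 2) k) with hT
  set Δ : ℕ → ℝ := fun k => x (Fin.ofNat (n + 2) (k + 1)) - x (Fin.ofNat (n + 2) k) with hΔdef
  set S : Fin (n + 1) → ℝ := fun i => ∑ j ∈ Finset.Ici i, θ j with hS
  have hsS : ∀ L k, s L k = σ * rexp (S (Fin.ofNat (n + 1) k) / √(L : ℝ)) := fun L k => by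
    simp only [hs, hS]; rw [Finset.sum_div]
  have hNi : ∀ L (i : Fin (n + 1)), N L i = τ L i.succ - τ L i.castSucc := fun L i => by
    simp only [hN]; rw [ofNat_succ, ofNat_castSucc]
  have hΔi : ∀ i : Fin (n + 1), Δ i = x i.succ - x i.castSucc := fun i => by
    simp only [hΔdef]; rw [ofNat_succ, ofNat_castSucc]
  have hrlim : ∀ k, Tendsto (fun L : ℕ => √(L : ℝ) * (1 - r L k)) atTop (𝓝 (T k)) := fun k =>
    tendsto_endRatio a c q _
  have hTpos : ∀ k, 0 < T k := fun k => endRate_pos hq hq0 hqd _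
  have hρ := (eventually_one_sub_div_sqrt_pos c).and (eventually_one_sub_div_sqrt_pos a)
  have hr01 : ∀ᶠ L in atTop, ∀ k, 0 ≤ r L k ∧ r L k < 1 := by
    -- For each L the sequence `r L` takes only the n + 2 values indexed by i, so finitely many
    -- eventual bounds give all k at once.
    have : ∀ᶠ L : ℕ in atTop, ∀ i : Fin (n + 2), 0 < √(L : ℝ) * (1 - endRatio (1 - c / √(L : ℝ))
        (1 - a / √(L : ℝ)) (fun k => q k / √(L : ℝ)) i) :=
      eventually_all.2 fun i => (tendsto_endRatio a c q i).eventually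
        (lt_mem_nhds (endRate_pos hq hq0 hqd i))
    filter_upwards [this, hρ] with L h1 h2 k
    refine ⟨endRatio_nonneg h2.1.le h2.2.le _ _, ?_⟩
    have := pos_of_mul_pos_right (h1 (Fin.ofNat (n + 2) k)) (sqrt_nonneg _)
    simp only [hr]
    linarith
  have hslim : ∀ k, Tendsto (fun L => s L k) atTop (𝓝 σ) := fun k => by
    simp_rw [hsS]
    have := ((Real.continuous_exp.tendsto 0).comp
      (tendsto_div_sqrt_natCast (S (Fin.ofNat (n + 1) k)))).const_mul σ
    simpa [Function.comp_def] using this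
  obtain ⟨hchain, hlimN⟩ := tendsto_integral_chainDensity hσ n hrlim hTpos hr01 hslim
    (N := N) (Δ := Δ) (fun k hk => by
      have h := hNlim ⟨k, hk⟩
      rw [← hΔi ⟨k, hk⟩] at h
      exact h.congr fun L => by rw [← hNi L ⟨k, hk⟩])
    (fun k hk => by rw [hΔi ⟨k, hk⟩]; exact hΔ ⟨k, hk⟩)
  have hae : ∀ᵐ u ∂(Measure.pi fun _ : Fin (n + 1) => volume.restrict (Ioi (0 : ℝ))),
      chainLimit σ T Δ n u = 1 / π * limitIntegrand a c σ x q u := by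
    rw [← restrict_forall_pos]
    have hmeas : MeasurableSet {u : Fin (n + 1) → ℝ | ∀ k, 0 < u k} := by
      rw [setOf_forall_pos_eq]; exact MeasurableSet.univ_pi fun _ => measurableSet_Ioi
    filter_upwards [ae_restrict_mem hmeas] with u hu
    exact chainLimit_eq (fun k => rfl) hΔi hu
  set I := ∫ u in {u : Fin (n + 1) → ℝ | ∀ k, 0 < u k}, limitIntegrand a c σ x q u with hI
  have hI' : ∫ u, limitIntegrand a c σ x q u
      ∂(Measure.pi fun _ : Fin (n + 1) => volume.restrict (Ioi (0 : ℝ))) = I := by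
    rw [hI, restrict_forall_pos]
  rw [integral_congr_ae hae, integral_const_mul, hI'] at hlimN
  have hint : IntegrableOn (limitIntegrand a c σ x q) {u : Fin (n + 1) → ℝ | ∀ k, 0 < u k} := by
    rw [IntegrableOn, restrict_forall_pos]
    refine (hchain.const_mul π).congr (hae.mono fun u hu => ?_)
    simp only
    rw [hu]; field_simp
  -- the total weight and the weighted sum of the exponentials
  have hC : ∀ᶠ L : ℕ in atTop, HasSum (fun γ : MotzkinPath L => γ.weight a c σ)
      (motzkinNormConst a c σ L) := by
    filter_upwards [hsumC, hρ, eventually_gt_atTop 0] with L h1 h2 hL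
    exact (hasSum_weight hL hσ.le h2.1.le h2.2.le h1).summable.hasSum
  have hClim : Tendsto (fun L : ℕ => motzkinNormConst a c σ L / (√(L : ℝ) * (2 + σ) ^ L)) atTop
      (𝓝 (s₀ * 𝔎)) := by
    refine hlimC.congr' ?_
    filter_upwards [hsumC, hρ, eventually_gt_atTop 0] with L h1 h2 hL
    rw [motzkinNormConst, (hasSum_weight hL hσ.le h2.1.le h2.2.le h1).tsum_eq]
  have hCpos : ∀ᶠ L : ℕ in atTop, 0 < motzkinNormConst a c σ L := by
    filter_upwards [hClim.eventually (lt_mem_nhds (mul_pos hs₀0 hK)), eventually_gt_atTop 0]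
      with L h hL
    have : 0 < √(L : ℝ) * (2 + σ) ^ L := by positivity
    exact (div_pos_iff_of_pos_right this).1 h
  set J : ℕ → ℝ := fun L =>
    ∫ u, chainDensity (angleDensity L) (angle L) (r L) (s L) (N L) n u *
      sinGen (r L (n + 1)) (angle L (u (Fin.last n)))
      ∂(Measure.pi fun _ => volume.restrict (Ioi 0)) with hJ
  set X : ℕ → ℝ := fun L => rexp (-(σ / (2 + σ) * ∑ k : Fin (n + 1),
    θ k / √(L : ℝ) * (τ L k.succ : ℝ))) with hX
  have hE : ∀ᶠ L : ℕ in atTop, HasSum (fun γ : MotzkinPath L => γ.weight a c σ *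
      motzkinExp σ x L (fun k => q k / √(L : ℝ)) (fun k => θ k / √(L : ℝ)) γ) (X L * J L) := by
    filter_upwards [hr01, hρ, hτstrict, eventually_gt_atTop 0] with L h1 h2 h3 hL
    exact hasSum_weight_mul_motzkinExp hσ.le h2.1.le h2.2.le _ _ (fun k => rfl) h3 (hτ0 L) (hτ1 L)
      ((isSineBasis_angle hL).hasSum_blockFun (fun k => (h1 k).1) (fun k => (h1 k).2) n)
  -- The centring and the top eigenvalues 2 + s of the blocks are compared with (2 + σ)^L. The block
  -- lengths add up to L, so the ratio splits into one Bernoulli factor per block.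
  have hXlim : Tendsto (fun L : ℕ => X L * (∏ i : Fin (n + 1), (2 + s L i) ^ N L i) / (2 + σ) ^ L)
      atTop (𝓝 (rexp (σ / (2 + σ) ^ 2 *
        ∑ k : Fin (n + 1), (x k.succ - x k.castSucc) * S k ^ 2))) := by
    have h1 := tendsto_finsetProd Finset.univ fun (i : Fin (n + 1)) _ =>
      tendsto_tilt_pow hσ (S i) (hNlim i)
    rw [← Real.exp_sum, ← Finset.mul_sum] at h1
    refine h1.congr fun L => ?_
    have e1 : X L = ∏ i : Fin (n + 1), rexp (-(σ / (2 + σ) * (S i / √(L : ℝ)))) ^ N L i := by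
      simp_rw [← Real.exp_nat_mul]
      rw [← Real.exp_sum, hX]
      simp only
      rw [sum_mul_succ_eq (fun k => (τ L k : ℝ)) (by simp [hτ0]) (fun k => θ k / √(L : ℝ)),
        Finset.mul_sum, ← Finset.sum_neg_distrib]
      congr 1
      refine Finset.sum_congr rfl fun i _ => ?_
      rw [hNi, Nat.cast_sub (hτmono L i.castSucc_lt_succ.le), ← Finset.sum_div]
      ring
    have e2 : (2 + σ) ^ L = ∏ i : Fin (n + 1), (2 + σ) ^ N L i := by
      rw [Finset.prod_pow_eq_pow_sum]
      congr 1
      have h := sum_sub_eq fun k => (τ L k : ℝ)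
      simp only [hτ0, hτ1, Nat.cast_zero, sub_zero] at h
      have h' : ((∑ i : Fin (n + 1), N L i : ℕ) : ℝ) = L := by
        rw [← h, Nat.cast_sum]
        refine Finset.sum_congr rfl fun i _ => ?_
        rw [hNi, Nat.cast_sub (hτmono L i.castSucc_lt_succ.le)]
      exact_mod_cast h'.symm
    rw [e1, e2, ← Finset.prod_mul_distrib, ← Finset.prod_div_distrib]
    refine Finset.prod_congr rfl fun i _ => ?_
    rw [← hNi, ← mul_pow, ← div_pow, mul_div_assoc, hsS, ofNat_val]
  -- the Laplace transform is the quotient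
  have hlaw : ∀ L, 0 < motzkinNormConst a c σ L → 0 ≤ 1 - c / √(L : ℝ) → 0 ≤ 1 - a / √(L : ℝ) →
      ∀ γ : MotzkinPath L,
      (ENNReal.ofReal (γ.weight a c σ / motzkinNormConst a c σ L)).toReal =
        γ.weight a c σ / motzkinNormConst a c σ L := fun L h h1 h2 γ =>
    ENNReal.toReal_ofReal (div_nonneg (γ.weight_nonneg hσ.le h1 h2) h.le)
  refine ⟨?_, hK, hint, ?_⟩
  · filter_upwards [hC, hCpos, hE, hρ] with L h1 h2 h3 h4
    constructor
    · constructor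
      rw [motzkinLaw, Measure.sum_apply _ MeasurableSet.univ]
      simp only [Measure.smul_apply, measure_univ, smul_eq_mul, mul_one]
      rw [← ENNReal.ofReal_tsum_of_nonneg
        (fun γ => div_nonneg (γ.weight_nonneg hσ.le h4.1.le h4.2.le) h2.le)
        (h1.summable.div_const _), tsum_div_const, h1.tsum_eq, div_self h2.ne', ENNReal.ofReal_one]
    · rw [motzkinLaw, integrable_sum_dirac_iff fun _ => ENNReal.ofReal_ne_top]
      refine (h3.summable.div_const (motzkinNormConst a c σ L)).congr fun γ => ?_
      rw [hlaw L h2 h4.1.le h4.2.le, Real.norm_of_nonneg (show 0 ≤ motzkinExp σ x L _ _ γ from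
        (Real.exp_pos _).le)]
      ring
  · have hquot : ∀ᶠ L : ℕ in atTop, motzkinLaplace a c σ x L
        (fun k => q k / √(L : ℝ)) (fun k => θ k / √(L : ℝ)) =
        X L * J L / motzkinNormConst a c σ L := by
      filter_upwards [hCpos, hE, hρ] with L h2 h3 h4
      rw [motzkinLaplace, motzkinLaw, integral_sum_dirac fun _ => ENNReal.ofReal_ne_top]
      simp_rw [hlaw L h2 h4.1.le h4.2.le]
      rw [← h3.tsum_eq, ← tsum_div_const]
      refine tsum_congr fun γ => ?_
      rw [smul_eq_mul]; ring
    -- The factors √L and (2 + σ)^L are common to numerator and denominator and cancel.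
    have hlim := (hXlim.mul hlimN).div hClim (mul_pos hs₀0 hK).ne'
    have hval : rexp (σ / (2 + σ) ^ 2 * ∑ k : Fin (n + 1), (x k.succ - x k.castSucc) * S k ^ 2) *
        (1 / π * I) / (s₀ * 𝔎) = limitPsi a c σ x q *
        rexp (σ / (2 + σ) ^ 2 * ∑ k : Fin (n + 1), (x k.succ - x k.castSucc) * S k ^ 2) := by
      rw [limitPsi, ← h𝔎, ← hI, hs₀, Real.sqrt_div (by norm_num)]
      have : √(2 + σ) ≠ 0 := by positivity
      field_simp
    rw [hval] at hlim
    refine hlim.congr' ?_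
    have hspos : ∀ᶠ L in atTop, ∀ i : Fin (n + 1), 0 < 2 + s L i :=
      .of_forall fun L i => by rw [hsS]; positivity
    filter_upwards [hquot, hCpos, hspos, eventually_gt_atTop 0] with L h1 h2 h3 hL
    rw [h1]
    have hsq : √(L : ℝ) ≠ 0 := by positivity
    have hP : ∏ i : Fin (n + 1), (2 + s L i) ^ N L i ≠ 0 :=
      Finset.prod_ne_zero_iff.2 fun i _ => pow_ne_zero _ (h3 i).ne'
    have h2σ : (2 + σ) ^ L ≠ 0 := by positivity
    have hC0 := h2.ne'
    simp only [Pi.div_apply]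
    change _ * (_ * J L) / _ = _
    field_simp
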